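/- \textbf{Setting.} Let $\Omega_1,\dots,\Omega_d$ be finite sets. A $d$-partite complex $X$ is a probability distribution $\Pi$ on $\Omega_1\times\cdots\times\Omega_d$, and $X(d)$ is its support; for $f:X(d)\to\mathbb{R}$ and $p\ge 1$ put $\|f\|_p=\mathbb{E}_{x\sim\Pi}[|f(x)|^p]^{1/p}$. For $S\subseteq[d]$ and $\tau$ in the support of the marginal $X[S]$ of $\Pi$ on the coordinates in $S$, the link $X_\tau$ is the distribution of $x\sim\Pi$ conditioned on $x_S=\tau$, and $f|_\tau$ is $f$ regarded as a function on $X_\tau$, with norms taken with respect to $X_\tau$. $X$ is a $\gamma$-product if for every such $\tau$ and all distinct $i,j\in[d]\setminus S$, the bipartite walk operator $A^\tau_{i,j}g(b)=\mathbb{E}_{x\sim X_\tau}[g(x_i)\mid x_j=b]$ satisfies $\lambda_2(A^\tau_{i,j})=\|A^\tau_{i,j}-\Pi^\tau_{i,j}\|_{2\to 2}\le\gamma$, where $\Pi^\tau_{i,j}g=\mathbb{E}_{x\sim X_\tau}[g(x_i)]$. The noise operator is $T_\rho f(y)=\sum_{S\subseteq[d]}\rho^{|S|}(1-\rho)^{d-|S|}\,\mathbb{E}_{x\sim\Pi}[f(x)\mid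 x_S=y_S]$. A function $f$ is $r$-global if $\|f|_{x_S}\|_2\le r^{|S|}\|f\|_2$ for all $S\subseteq[d]$ and all $x_S\in\mathrm{Supp}(X[S])$. \textbf{Corollary (Global Hypercontractivity, operator form).} There are absolute constants $C,\kappa>0$ and functions $c_{d,q}$ of $\gamma$, depending only on $d$ and $q$, with $c_{d,q}(\gamma)\to 0$ as $\gamma\to 0^+$ for all $d,q$, such that the following holds. Let $q>2$ be an even integer and let $0<\gamma\le 2^{-C\,q\,d\log q}$. Then \[ c_{d,q}(\gamma)\le \frac{C\,q\,d\log q}{\log(1/\gamma)}, \] and for every $d$-partite $\gamma$-product $X$, every $r\ge 1$, every $0\le\rho\le\frac{\kappa}{rq}$ and every $r$-global $f:X(d)\to\mathbb{R}$, \[ \|T_\rho f\|_q\le(1+c_{d,q}(\gamma))\,\|f\|_2 . \] -/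

import Mathlib

open Filter Topology

universe u

noncomputable section

/-- A weighted `d`-partite complex with finite vertex parts `Ω 0, …, Ω (d-1)`, given by the
probability distribution `Π` of its top-level faces `x = (x_1, …, x_d)`. The set `X(d)` of top-level
faces is the support of `weight`. -/
structure PartiteComplex {d : ℕ} (Ω : Fin d → Type u) [∀ i, Fintype (Ω i)] where
  weight : (∀ i, Ω i) → ℝ
  weight_nonneg : ∀ x, 0 ≤ weight x
  weight_sum : ∑ x, weight x = 1

namespace PartiteComplex

variable {d : ℕ} {Ω : Fin d → Type u} [∀ i, Fintype (Ω i)]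

/-- `𝔼[f] = ∑ x, Π(x) f(x)`. -/
def expect (X : PartiteComplex Ω) (f : (∀ i, Ω i) → ℝ) : ℝ :=
  ∑ x, X.weight x * f x

/-- `‖f‖_p = 𝔼[|f|^p]^{1/p}`. -/
def pNorm (X : PartiteComplex Ω) (p : ℝ) (f : (∀ i, Ω i) → ℝ) : ℝ :=
  (X.expect fun x => |f x| ^ p) ^ (1 / p)

open Classical in
/-- The probability `Pr[φ(x) = b]` for `x` drawn from `X`. -/
def prob {β : Type u} (X : PartiteComplex Ω) (φ : (∀ i, Ω i) → β) (b : β) : ℝ :=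
  ∑ x with φ x = b, X.weight x

open Classical in
/-- The conditional expectation `𝔼[f(x) | φ(x) = b]` for `x` drawn from `X`
(only meaningful where `Pr[φ(x) = b] > 0`). -/
def condExpect {β : Type u} (X : PartiteComplex Ω) (φ : (∀ i, Ω i) → β)
    (f : (∀ i, Ω i) → ℝ) (b : β) : ℝ :=
  (∑ x with φ x = b, X.weight x * f x) / X.prob φ b

/-- The projection `x ↦ x_S` of a tuple to the coordinates in `S`. -/
def proj (S : Finset (Fin d)) (x : ∀ i, Ω i) : ∀ i : S, Ω i :=
  fun i => x i

/-- `τ` is a face of `X` with colour set `S`, that is `τ ∈ Supp(X[S])`. -/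
def IsFace (X : PartiteComplex Ω) (S : Finset (Fin d)) (τ : ∀ i : S, Ω i) : Prop :=
  0 < X.prob (proj S) τ

open Classical in
/-- The link `X_τ` of a face `τ` with colour set `S`: the distribution of `x` conditioned on
`x_S = τ`. We keep the (now constant) coordinates in `S` in the tuple, so that the restriction
`f|_τ` is simply `f`, regarded as a function on `X_τ`. -/
def link (X : PartiteComplex Ω) (S : Finset (Fin d)) (τ : ∀ i : S, Ω i) (hτ : X.IsFace S τ) :
    PartiteComplex Ω where
  weight x := if proj S x = τ then X.weight x / X.prob (proj S) τ else 0
  weight_nonneg x := by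
    split_ifs
    · exact div_nonneg (X.weight_nonneg x) (le_of_lt hτ)
    · exact le_rfl
  weight_sum := by
    rw [← Finset.sum_filter, ← Finset.sum_div]
    convert div_self (ne_of_gt hτ)
    simp only [prob]
    congr!

/-- The averaging operator `E_S f (y) = 𝔼[f(x) | x_S = y_S]`. -/
def avg (X : PartiteComplex Ω) (S : Finset (Fin d)) (f : (∀ i, Ω i) → ℝ) : (∀ i, Ω i) → ℝ :=
  fun y => X.condExpect (proj S) f (proj S y)

/-- The noise operator `T_ρ f = ∑_{S ⊆ [d]} ρ^{|S|} (1 - ρ)^{d - |S|} E_S f`. -/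
def noise (X : PartiteComplex Ω) (ρ : ℝ) (f : (∀ i, Ω i) → ℝ) : (∀ i, Ω i) → ℝ :=
  fun y => ∑ S : Finset (Fin d), ρ ^ S.card * (1 - ρ) ^ (d - S.card) * X.avg S f y

/-- The bipartite walk `A_{i,j}` from functions on colour `i` to functions on colour `j`,
`A_{i,j} g (b) = 𝔼[g(x_i) | x_j = b]`. -/
def walk (X : PartiteComplex Ω) (i j : Fin d) (g : Ω i → ℝ) : Ω j → ℝ :=
  fun b => X.condExpect (fun x => x j) (fun x => g (x i)) b

/-- `X` is a `γ`-product: in every link `X_τ` and for all colours `i ≠ j` outside `τ` (so that the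
link has co-dimension at least two), `λ₂(A^τ_{i,j}) = ‖A^τ_{i,j} - Π^τ_{i,j}‖_2 ≤ γ`, where
`Π^τ_{i,j} g = 𝔼_{X_τ}[g(x_i)]` is the stationary operator. The operator norm is taken from
`L_2` of the `i`-th marginal of `X_τ` to `L_2` of its `j`-th marginal. -/
def IsGammaProduct (X : PartiteComplex Ω) (γ : ℝ) : Prop :=
  ∀ (S : Finset (Fin d)) (τ : ∀ i : S, Ω i) (hτ : X.IsFace S τ) (i j : Fin d),
    i ≠ j → i ∉ S → j ∉ S → ∀ g : Ω i → ℝ,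
      (X.link S τ hτ).pNorm 2
          (fun x => (X.link S τ hτ).walk i j g (x j) - (X.link S τ hτ).expect fun y => g (y i)) ≤
        γ * (X.link S τ hτ).pNorm 2 fun x => g (x i)

/-- `f` is `r`-global: `‖f|_{x_S}‖_2 ≤ r^{|S|} ‖f‖_2` for all `S ⊆ [d]` and
`x_S ∈ Supp(X[S])`. -/
def IsGlobal (X : PartiteComplex Ω) (r : ℝ) (f : (∀ i, Ω i) → ℝ) : Prop :=
  ∀ (S : Finset (Fin d)) (τ : ∀ i : S, Ω i) (hτ : X.IsFace S τ),
    (X.link S τ hτ).pNorm 2 f ≤ r ^ S.card * X.pNorm 2 f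

end PartiteComplex

end

/-!
Throughout `E_S` is the conditional expectation given `x_S`, and `k = q / 2`.

The noise operator acts on the Efron–Stein components `f^{=S} = ∑_{T ⊆ S} (-1)^{|S ∖ T|} E_T f` as
on a product space: `T_ρ f = ∑_S ρ^{|S|} f^{=S}` holds identically. The spectral hypothesis enters
only through `IsGammaProduct.l2_avg_sub_avg_inter_le`: `E_U φ` and `E_{U ∩ S} φ` differ by at most
`d² γ ‖φ‖₂` in `L²` for a function `φ` of `x_S`. It is obtained from the bipartite walks in the
links by adding coordinates one at a time, passing to the adjoint in between. Consequently averaging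
over a coordinate `i ∈ S` almost annihilates `f^{=S}`.

The argument has two halves.

* A square function inequality (`expect_sum_pow_le_squareFunction`):
  `𝔼 (T_ρ f)^{2k} ≤ 𝔼 (∑_S (20 k ρ²)^{|S|} (f^{=S})²)^k + error`. It treats one coordinate `i` at a
  time. For the vector-valued function of all parts of `T_ρ f` produced so far, the difference from
  its average over `x_i` has conditional mean zero, and a pointwise inequality for
  `‖a + h‖^{2k}` (`add_two_mul_add_pow_le`) applies. This is exact on every complex;
  decorrelation is used only to recognise the new parts as sums of components.

* A moment bound for the square function (`expect_mul_squareFunction_pow_le`). The `k`-th power is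
  expanded and its factors are integrated out one after the other. Given a weight `P(x_U)` from the
  remaining factors, the components meeting `U` exactly in `B` are nearly orthogonal, and
  their sum is `r^{-|B|}` times an average of alternating sums of conditional expectations, once the
  components are rescaled by `r^{-|S|}`. Globalness bounds these by `r^{|B|}`, so that the factor
  costs at most `∑_{B ⊆ U} (4 w)^{|B|} = (1 + 4 w)^{|U|}` (`expect_mul_squareFunction_le`). Since
  `w` is of order `1 / k`, this can be absorbed into the weights of the other
  factors `k` times over.

After the rescaling by `r^{-|S|}` all components are bounded by `2^{|S|} ‖f‖₂` (globalness with
respect to all colour sets), so every `L²` error may be multiplied by bounded functions, and the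
total error is `γ` times a quantity depending on `d` and `q` only, of order `q^{O(q d)}`. The
hypothesis on `γ` makes this smaller than `C q d log q / log (1 / γ)`.
-/

set_option linter.unusedSectionVars false

noncomputable section

namespace PartiteComplex

/-! ### Expectations and conditional expectations on a finite complex -/

section Averages

variable {d : ℕ} {Ω : Fin d → Type u} [∀ i, Fintype (Ω i)] (X : PartiteComplex Ω)

lemma proj_eq_proj_iff {S : Finset (Fin d)} {x y : ∀ i, Ω i} :
    proj S x = proj S y ↔ ∀ i ∈ (S : Set (Fin d)), x i = y i := by
  simp [proj, funext_iff]

lemma proj_eq_mono {S T : Finset (Fin d)} (h : S ⊆ T) {x y : ∀ i, Ω i}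
    (hxy : proj T x = proj T y) : proj S x = proj S y :=
  proj_eq_proj_iff.2 fun i hi => proj_eq_proj_iff.1 hxy i (h hi)

lemma expect_add (f g : (∀ i, Ω i) → ℝ) :
    X.expect (fun x => f x + g x) = X.expect f + X.expect g := by
  simp [expect, mul_add, Finset.sum_add_distrib]

lemma expect_sub (f g : (∀ i, Ω i) → ℝ) :
    X.expect (fun x => f x - g x) = X.expect f - X.expect g := by
  simp [expect, mul_sub, Finset.sum_sub_distrib]

lemma expect_const_mul (a : ℝ) (f : (∀ i, Ω i) → ℝ) :
    X.expect (fun x => a * f x) = a * X.expect f := by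
  simp [expect, Finset.mul_sum, mul_left_comm]

lemma expect_sum {ι : Type*} (s : Finset ι) (f : ι → (∀ i, Ω i) → ℝ) :
    X.expect (fun x => ∑ a ∈ s, f a x) = ∑ a ∈ s, X.expect (f a) := by
  simp only [expect, Finset.mul_sum]
  exact Finset.sum_comm

lemma expect_const (a : ℝ) : X.expect (fun _ => a) = a := by
  simp [expect, ← Finset.sum_mul, X.weight_sum]

lemma expect_mono {f g : (∀ i, Ω i) → ℝ} (h : ∀ x, 0 < X.weight x → f x ≤ g x) :
    X.expect f ≤ X.expect g := by
  refine Finset.sum_le_sum fun x _ => ?_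
  rcases (X.weight_nonneg x).eq_or_lt with h0 | h0
  · simp [← h0]
  · exact mul_le_mul_of_nonneg_left (h x h0) h0.le

lemma expect_congr {f g : (∀ i, Ω i) → ℝ} (h : ∀ x, 0 < X.weight x → f x = g x) :
    X.expect f = X.expect g :=
  le_antisymm (X.expect_mono fun x hx => (h x hx).le) (X.expect_mono fun x hx => (h x hx).ge)

lemma expect_nonneg {f : (∀ i, Ω i) → ℝ} (h : ∀ x, 0 < X.weight x → 0 ≤ f x) :
    0 ≤ X.expect f := by
  simpa [expect] using X.expect_mono (f := fun _ => 0) h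

open Classical in
/-- The mass of the cylinder through `y` with base `S`. -/
def mass (S : Finset (Fin d)) (y : ∀ i, Ω i) : ℝ := X.prob (proj S) (proj S y)

open Classical in
lemma mass_eq (S : Finset (Fin d)) (y : ∀ i, Ω i) :
    X.mass S y = ∑ x, if proj S x = proj S y then X.weight x else 0 := by
  rw [mass, prob, Finset.sum_filter]
  congr!

lemma weight_le_mass (S : Finset (Fin d)) (y : ∀ i, Ω i) : X.weight y ≤ X.mass S y := by
  classical
  rw [mass_eq]
  have := Finset.single_le_sum (f := fun x => if proj S x = proj S y then X.weight x else 0)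
    (fun x _ => by split_ifs; exacts [X.weight_nonneg x, le_rfl]) (Finset.mem_univ y)
  simpa using this

lemma mass_nonneg (S : Finset (Fin d)) (y : ∀ i, Ω i) : 0 ≤ X.mass S y :=
  (X.weight_nonneg y).trans (X.weight_le_mass S y)

lemma mass_pos (S : Finset (Fin d)) {y : ∀ i, Ω i} (hy : 0 < X.weight y) : 0 < X.mass S y :=
  hy.trans_le (X.weight_le_mass S y)

lemma isFace_proj (S : Finset (Fin d)) {y : ∀ i, Ω i} (hy : 0 < X.weight y) :
    X.IsFace S (proj S y) := X.mass_pos S hy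

open Classical in
lemma avg_eq (S : Finset (Fin d)) (f : (∀ i, Ω i) → ℝ) (y : ∀ i, Ω i) :
    X.avg S f y = (∑ x, if proj S x = proj S y then X.weight x * f x else 0) / X.mass S y := by
  rw [avg, condExpect, mass, Finset.sum_filter]
  congr!

lemma dependsOn_avg (S : Finset (Fin d)) (f : (∀ i, Ω i) → ℝ) :
    DependsOn (X.avg S f) (S : Set (Fin d)) := by
  intro x y h
  rw [avg, avg, proj_eq_proj_iff.2 h]

lemma avg_congr {S : Finset (Fin d)} {f g : (∀ i, Ω i) → ℝ} {y : ∀ i, Ω i}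
    (h : ∀ x, proj S x = proj S y → f x = g x) : X.avg S f y = X.avg S g y := by
  classical
  rw [avg_eq, avg_eq]
  congr 1
  refine Finset.sum_congr rfl fun x _ => ?_
  split_ifs with hx
  · rw [h x hx]
  · rfl

lemma avg_add (S : Finset (Fin d)) (f g : (∀ i, Ω i) → ℝ) (y : ∀ i, Ω i) :
    X.avg S (fun x => f x + g x) y = X.avg S f y + X.avg S g y := by
  simp [avg, condExpect, mul_add, Finset.sum_add_distrib, add_div]

lemma avg_sub (S : Finset (Fin d)) (f g : (∀ i, Ω i) → ℝ) (y : ∀ i, Ω i) :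
    X.avg S (fun x => f x - g x) y = X.avg S f y - X.avg S g y := by
  simp [avg, condExpect, mul_sub, Finset.sum_sub_distrib, sub_div]

lemma avg_const_mul (S : Finset (Fin d)) (a : ℝ) (f : (∀ i, Ω i) → ℝ) (y : ∀ i, Ω i) :
    X.avg S (fun x => a * f x) y = a * X.avg S f y := by
  simp [avg, condExpect, mul_left_comm _ a, ← Finset.mul_sum, mul_div_assoc]

lemma avg_sum {ι : Type*} (S : Finset (Fin d)) (s : Finset ι) (f : ι → (∀ i, Ω i) → ℝ)
    (y : ∀ i, Ω i) :
    X.avg S (fun x => ∑ a ∈ s, f a x) y = ∑ a ∈ s, X.avg S (f a) y := by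
  simp only [avg, condExpect, Finset.mul_sum, ← Finset.sum_div]
  rw [Finset.sum_comm]

lemma avg_mono {S : Finset (Fin d)} {f g : (∀ i, Ω i) → ℝ}
    (h : ∀ x, 0 < X.weight x → f x ≤ g x) (y : ∀ i, Ω i) : X.avg S f y ≤ X.avg S g y := by
  classical
  rw [avg_eq, avg_eq]
  refine div_le_div_of_nonneg_right (Finset.sum_le_sum fun x _ => ?_) (X.mass_nonneg S y)
  split_ifs
  · rcases (X.weight_nonneg x).eq_or_lt with h0 | h0
    · simp [← h0]
    · exact mul_le_mul_of_nonneg_left (h x h0) h0.le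
  · exact le_rfl

lemma avg_eq_self {S : Finset (Fin d)} {f : (∀ i, Ω i) → ℝ} (hf : DependsOn f (S : Set (Fin d)))
    {y : ∀ i, Ω i} (hy : 0 < X.weight y) : X.avg S f y = f y := by
  classical
  rw [X.avg_congr (g := fun _ => f y) fun x hx => hf (proj_eq_proj_iff.1 hx), avg_eq,
    div_eq_iff (X.mass_pos S hy).ne', mass_eq, Finset.mul_sum]
  refine Finset.sum_congr rfl fun x _ => ?_
  split_ifs <;> ring

lemma abs_avg_le {S : Finset (Fin d)} {f : (∀ i, Ω i) → ℝ} {M : ℝ}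
    (h : ∀ x, 0 < X.weight x → |f x| ≤ M) {y : ∀ i, Ω i} (hy : 0 < X.weight y) :
    |X.avg S f y| ≤ M := by
  have hc : ∀ a : ℝ, X.avg S (fun _ => a) y = a := fun a =>
    X.avg_eq_self (f := fun _ => a) (fun _ _ _ => rfl) hy
  rw [abs_le]
  constructor
  · rw [← hc (-M)]
    exact X.avg_mono (fun x hx => (abs_le.1 (h x hx)).1) y
  · rw [← hc M]
    exact X.avg_mono (fun x hx => (abs_le.1 (h x hx)).2) y

/-- Conditional Jensen for the square. It also holds off the support, where both sides are `0`. -/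
lemma sq_avg_le (S : Finset (Fin d)) (f : (∀ i, Ω i) → ℝ) (y : ∀ i, Ω i) :
    X.avg S f y ^ 2 ≤ X.avg S (fun x => f x ^ 2) y := by
  classical
  rcases (X.mass_nonneg S y).eq_or_lt with h0 | h0
  · rw [avg_eq, avg_eq, ← h0]; simp
  · rw [avg_eq, avg_eq, div_pow, div_le_div_iff₀ (by positivity) h0, sq (X.mass S y), ← mul_assoc]
    refine mul_le_mul_of_nonneg_right ?_ h0.le
    rw [mass_eq, mul_comm]
    refine Finset.sum_sq_le_sum_mul_sum_of_sq_le_mul _ (fun x _ => ?_) (fun x _ => ?_)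
      (fun x _ => ?_)
    · split_ifs; exacts [X.weight_nonneg x, le_rfl]
    · split_ifs; exacts [mul_nonneg (X.weight_nonneg x) (sq_nonneg _), le_rfl]
    · split_ifs <;> exact le_of_eq (by ring)

/-- The defining property of conditional expectation. -/
lemma expect_mul_avg {S : Finset (Fin d)} {g : (∀ i, Ω i) → ℝ}
    (hg : DependsOn g (S : Set (Fin d))) (f : (∀ i, Ω i) → ℝ) :
    X.expect (fun x => g x * X.avg S f x) = X.expect fun x => g x * f x := by
  classical
  simp only [expect, avg_eq, Finset.sum_div, Finset.mul_sum]
  rw [Finset.sum_comm]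
  refine Finset.sum_congr rfl fun x _ => ?_
  have : ∀ y, X.weight y * (g y * ((if proj S x = proj S y then X.weight x * f x else 0) /
      X.mass S y)) = (if proj S y = proj S x then X.weight y else 0) *
        (X.weight x * (g x * f x) / X.mass S x) := by
    intro y
    by_cases h : proj S x = proj S y
    · rw [if_pos h, if_pos h.symm, hg (proj_eq_proj_iff.1 h), mass, mass, h]
      ring
    · rw [if_neg h, if_neg (Ne.symm h)]
      simp
  simp only [this]
  rw [← Finset.sum_mul, ← mass_eq]
  rcases (X.weight_nonneg x).eq_or_lt with h0 | h0
  · simp [← h0]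
  · rw [mul_div_cancel₀ _ (X.mass_pos S h0).ne']

lemma expect_avg (S : Finset (Fin d)) (f : (∀ i, Ω i) → ℝ) :
    X.expect (X.avg S f) = X.expect f := by
  simpa using X.expect_mul_avg (S := S) (g := fun _ => 1) (fun _ _ _ => rfl) f

/-- The tower property. -/
lemma avg_avg {S T : Finset (Fin d)} (h : S ⊆ T) (f : (∀ i, Ω i) → ℝ) (y : ∀ i, Ω i) :
    X.avg S (X.avg T f) y = X.avg S f y := by
  classical
  have key := X.expect_mul_avg (S := T) (g := fun x => if proj S x = proj S y then 1 else 0)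
    (fun a b hab => by
      have : proj S a = proj S b := proj_eq_mono h (proj_eq_proj_iff.2 hab)
      simp only [this]) f
  simp only [expect, ite_mul, one_mul, zero_mul, mul_ite, mul_zero] at key
  rw [avg_eq, avg_eq, key]

lemma dependsOn_sum {ι : Type*} {S : Set (Fin d)} (s : Finset ι) {f : ι → (∀ i, Ω i) → ℝ}
    (h : ∀ a ∈ s, DependsOn (f a) S) : DependsOn (fun x => ∑ a ∈ s, f a x) S :=
  fun _ _ hxy => Finset.sum_congr rfl fun a ha => h a ha hxy

/-- The norm of `L²(X)`, a seminorm on functions on the full product. -/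
def l2 (f : (∀ i, Ω i) → ℝ) : ℝ :=
  ‖(WithLp.toLp 2 fun x => √(X.weight x) * f x : EuclideanSpace ℝ (∀ i, Ω i))‖

lemma l2_sq (f : (∀ i, Ω i) → ℝ) : X.l2 f ^ 2 = X.expect fun x => f x ^ 2 := by
  simp [l2, EuclideanSpace.norm_sq_eq, expect, mul_pow, Real.sq_sqrt (X.weight_nonneg _)]

lemma l2_nonneg (f : (∀ i, Ω i) → ℝ) : 0 ≤ X.l2 f := norm_nonneg _

@[simp]
lemma l2_zero : X.l2 (fun _ => 0) = 0 := by
  simpa [expect] using X.l2_sq fun _ => 0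

lemma l2_add_le (f g : (∀ i, Ω i) → ℝ) : X.l2 (fun x => f x + g x) ≤ X.l2 f + X.l2 g := by
  refine le_of_eq_of_le ?_ (norm_add_le _ _)
  rw [l2]
  congr 1
  ext x
  simp [mul_add]

lemma l2_const_mul (a : ℝ) (f : (∀ i, Ω i) → ℝ) : X.l2 (fun x => a * f x) = |a| * X.l2 f := by
  rw [l2, l2, ← Real.norm_eq_abs, ← norm_smul]
  congr 1
  ext x
  simp [mul_left_comm]

lemma l2_sum_le {ι : Type*} (s : Finset ι) (f : ι → (∀ i, Ω i) → ℝ) :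
    X.l2 (fun x => ∑ a ∈ s, f a x) ≤ ∑ a ∈ s, X.l2 (f a) := by
  refine le_of_eq_of_le ?_ (norm_sum_le _ _)
  rw [l2]
  congr 1
  ext x
  simp [Finset.mul_sum]

lemma l2_le_of_sq_le {f : (∀ i, Ω i) → ℝ} {a : ℝ} (ha : 0 ≤ a)
    (h : X.expect (fun x => f x ^ 2) ≤ a ^ 2) : X.l2 f ≤ a :=
  abs_le_of_sq_le_sq' (by rwa [l2_sq]) ha |>.2

lemma l2_congr {f g : (∀ i, Ω i) → ℝ} (h : ∀ x, 0 < X.weight x → f x = g x) :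
    X.l2 f = X.l2 g := by
  have : X.l2 f ^ 2 = X.l2 g ^ 2 := by
    rw [l2_sq, l2_sq]
    exact X.expect_congr fun x hx => by rw [h x hx]
  exact (sq_eq_sq₀ (X.l2_nonneg f) (X.l2_nonneg g)).1 this

lemma expect_mul_le (f g : (∀ i, Ω i) → ℝ) :
    X.expect (fun x => f x * g x) ≤ X.l2 f * X.l2 g := by
  refine le_of_eq_of_le ?_ (real_inner_le_norm _ _)
  simp only [expect, PiLp.inner_apply]
  refine Finset.sum_congr rfl fun x _ => ?_
  simp only [RCLike.inner_apply, conj_trivial]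
  linear_combination (-(f x * g x)) * Real.mul_self_sqrt (X.weight_nonneg x)

lemma expect_abs_le_l2 (f : (∀ i, Ω i) → ℝ) : X.expect (fun x => |f x|) ≤ X.l2 f := by
  have h := X.expect_mul_le (fun x => |f x|) fun _ => 1
  have h1 : X.l2 (fun _ => 1) ^ 2 = 1 := by simp [l2_sq, expect_const]
  have h2 : X.l2 (fun x => |f x|) ^ 2 = X.l2 f ^ 2 := by simp [l2_sq]
  rw [(sq_eq_sq₀ (X.l2_nonneg _) (X.l2_nonneg _)).1 h2,
    (sq_eq_sq₀ (X.l2_nonneg _) zero_le_one).1 (h1.trans (one_pow 2).symm)] at h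
  simpa using h

lemma l2_avg_le (S : Finset (Fin d)) (f : (∀ i, Ω i) → ℝ) : X.l2 (X.avg S f) ≤ X.l2 f := by
  refine X.l2_le_of_sq_le (X.l2_nonneg f) ?_
  rw [l2_sq, ← X.expect_avg S fun x => f x ^ 2]
  exact X.expect_mono fun x _ => X.sq_avg_le S f x

end Averages

/-! ### Decorrelation of averaging operators on a `γ`-product -/

section Decorrelation

variable {d : ℕ} {Ω : Fin d → Type u} [∀ i, Fintype (Ω i)] (X : PartiteComplex Ω)

lemma pNorm_two_eq_l2 (f : (∀ i, Ω i) → ℝ) : X.pNorm 2 f = X.l2 f := by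
  rw [pNorm, ← Real.sqrt_eq_rpow, Real.sqrt_eq_iff_mul_self_eq _ (X.l2_nonneg f), ← sq, l2_sq]
  · simp
  · exact X.expect_nonneg fun x _ => by positivity

lemma expect_link {S : Finset (Fin d)} (y : ∀ i, Ω i) (hy : X.IsFace S (proj S y))
    (f : (∀ i, Ω i) → ℝ) : (X.link S (proj S y) hy).expect f = X.avg S f y := by
  classical
  rw [avg_eq, expect, Finset.sum_div]
  refine Finset.sum_congr rfl fun x _ => ?_
  simp only [link, mass]
  split_ifs <;> ring

lemma l2_link_sq {S : Finset (Fin d)} (y : ∀ i, Ω i) (hy : X.IsFace S (proj S y))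
    (f : (∀ i, Ω i) → ℝ) :
    (X.link S (proj S y) hy).l2 f ^ 2 = X.avg S (fun x => f x ^ 2) y := by
  rw [l2_sq, expect_link]

/-- In the link of `x_V`, the walk from colour `i` to colour `j` averages over `x_{V ∪ {j}}`. -/
lemma walk_link {V : Finset (Fin d)} {y x : ∀ i, Ω i} (hy : X.IsFace V (proj V y))
    (hx : proj V x = proj V y) (i j : Fin d) (g : Ω i → ℝ) :
    (X.link V (proj V y) hy).walk i j g (x j) = X.avg (insert j V) (fun z => g (z i)) x := by
  classical
  have hp : X.mass V y ≠ 0 := ne_of_gt hy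
  have key : ∀ φ : (∀ i, Ω i) → ℝ,
      (∑ z with z j = x j, (X.link V (proj V y) hy).weight z * φ z) =
        (∑ z, if proj (insert j V) z = proj (insert j V) x then X.weight z * φ z else 0) /
          X.mass V y := by
    intro φ
    rw [Finset.sum_filter, Finset.sum_div]
    refine Finset.sum_congr rfl fun z _ => ?_
    have : proj (insert j V) z = proj (insert j V) x ↔ z j = x j ∧ proj V z = proj V y := by
      rw [← hx, proj_eq_proj_iff, proj_eq_proj_iff]
      simp
    simp only [link, this, mass]
    by_cases h1 : z j = x j <;> by_cases h2 : proj V z = proj V y <;>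
      simp [h1, h2, div_mul_eq_mul_div]
  have h1 := key fun _ => 1
  simp only [mul_one] at h1
  rw [walk, condExpect, avg_eq, prob]
  have h2 := key fun z => g (z i)
  rw [← mass_eq] at h1
  have h3 : (∑ z with z j = x j, (X.link V (proj V y) hy).weight z * g (z i)) /
      (∑ z with z j = x j, (X.link V (proj V y) hy).weight z) =
      (∑ z, if proj (insert j V) z = proj (insert j V) x then X.weight z * g (z i) else 0) /
        X.mass (insert j V) x := by
    rw [h1, h2, div_div_div_cancel_right₀ hp]
  convert h3

variable {X} {γ : ℝ}

/-- The spectral hypothesis, integrated over all links of colour `V`. -/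
lemma IsGammaProduct.l2_avg_insert_sub_avg_le (hX : X.IsGammaProduct γ) (hγ : 0 ≤ γ)
    {V : Finset (Fin d)} {j s : Fin d} (hjs : j ≠ s) (hj : j ∉ V) (hs : s ∉ V)
    {ψ : (∀ i, Ω i) → ℝ} (hψ : DependsOn ψ (insert j V : Finset (Fin d))) :
    X.l2 (fun x => X.avg (insert s V) ψ x - X.avg V ψ x) ≤ γ * X.l2 ψ := by
  classical
  refine X.l2_le_of_sq_le (mul_nonneg hγ (X.l2_nonneg ψ)) ?_
  rw [mul_pow, l2_sq, ← X.expect_avg V, ← X.expect_avg V fun x => ψ x ^ 2, ← expect_const_mul]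
  refine X.expect_mono fun y hy => ?_
  have hf := X.isFace_proj V hy
  let g : Ω j → ℝ := fun b => ψ (Function.update y j b)
  have hg : ∀ x, proj V x = proj V y → ψ x = g (x j) := by
    intro x hx
    refine hψ fun i hi => ?_
    rcases eq_or_ne i j with rfl | hij
    · simp
    · rw [Function.update_of_ne hij]
      refine proj_eq_proj_iff.1 hx i ?_
      simpa [hij] using hi
  have h := hX V (proj V y) hf j s hjs hj hs g
  rw [pNorm_two_eq_l2, pNorm_two_eq_l2] at h
  have h2 := pow_le_pow_left₀ (l2_nonneg _ _) h 2
  rw [mul_pow, l2_link_sq, l2_link_sq, expect_link] at h2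
  refine le_of_eq_of_le (X.avg_congr fun x hx => ?_) (h2.trans (le_of_eq ?_))
  · rw [X.walk_link hf hx]
    have e1 : X.avg (insert s V) ψ x = X.avg (insert s V) (fun z => g (z j)) x :=
      X.avg_congr fun z hz => hg z ((proj_eq_mono (Finset.subset_insert _ _) hz).trans hx)
    have e2 : X.avg V ψ x = X.avg V (fun z => g (z j)) y := by
      rw [X.dependsOn_avg V ψ (proj_eq_proj_iff.1 hx)]
      exact X.avg_congr hg
    rw [e1, e2]
  · congr 1
    exact X.avg_congr fun x hx => by rw [hg x hx]

/-- Conditioning a function of `x_{V ∪ {j}}` on further coordinates `T ∌ j` changes its conditional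
expectation given `x_V` by little: the coordinates of `T` are added one at a time. -/
lemma IsGammaProduct.l2_avg_union_sub_avg_le (hX : X.IsGammaProduct γ) (hγ : 0 ≤ γ)
    {V : Finset (Fin d)} {j : Fin d} (hj : j ∉ V)
    {ψ : (∀ i, Ω i) → ℝ} (hψ : DependsOn ψ (insert j V : Finset (Fin d)))
    (T : Finset (Fin d)) (hT : j ∉ T) :
    X.l2 (fun x => X.avg (V ∪ T) ψ x - X.avg V ψ x) ≤ T.card * γ * X.l2 ψ := by
  classical
  induction T using Finset.induction_on with
  | empty => simp
  | insert s T hs ih =>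
    have hjs : j ≠ s := fun h => hT (h ▸ Finset.mem_insert_self _ _)
    have hjT : j ∉ T := fun h => hT (Finset.mem_insert_of_mem h)
    have step : X.l2 (fun x => X.avg (V ∪ insert s T) ψ x - X.avg (V ∪ T) ψ x) ≤ γ * X.l2 ψ := by
      rw [Finset.union_insert]
      by_cases hsV : s ∈ V ∪ T
      · rw [Finset.insert_eq_of_mem hsV]
        simpa using mul_nonneg hγ (X.l2_nonneg ψ)
      · refine hX.l2_avg_insert_sub_avg_le hγ hjs (by simp [hj, hjT]) hsV (hψ.mono ?_)
        exact_mod_cast Finset.insert_subset_insert _ Finset.subset_union_left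
    have tri := X.l2_add_le (fun x => X.avg (V ∪ insert s T) ψ x - X.avg (V ∪ T) ψ x)
      (fun x => X.avg (V ∪ T) ψ x - X.avg V ψ x)
    simp only [sub_add_sub_cancel] at tri
    rw [Finset.card_insert_of_notMem hs]
    push_cast
    linarith [ih hjT]

/-- The dual statement: conditioning on one further coordinate `j ∉ S` hardly changes the
conditional expectation of a function of `x_S`. -/
lemma IsGammaProduct.l2_avg_insert_sub_avg_le_of_dependsOn (hX : X.IsGammaProduct γ) (hγ : 0 ≤ γ)
    {S : Finset (Fin d)} {φ : (∀ i, Ω i) → ℝ} (hφ : DependsOn φ (S : Set (Fin d)))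
    {j : Fin d} (hj : j ∉ S) (V : Finset (Fin d)) :
    X.l2 (fun x => X.avg (insert j V) φ x - X.avg V φ x) ≤ d * γ * X.l2 φ := by
  classical
  have hpos : 0 ≤ d * γ * X.l2 φ := mul_nonneg (mul_nonneg (Nat.cast_nonneg d) hγ) (X.l2_nonneg φ)
  by_cases hjV : j ∈ V
  · rw [Finset.insert_eq_of_mem hjV]
    simpa using hpos
  set ψ : (∀ i, Ω i) → ℝ := fun x => X.avg (insert j V) φ x - X.avg V φ x with hψdef
  have hVj : V ⊆ insert j V := Finset.subset_insert _ _
  have hψ : DependsOn ψ (insert j V : Finset (Fin d)) := fun x y h => by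
    simp only [hψdef]
    rw [X.dependsOn_avg _ φ h, X.dependsOn_avg V φ fun i hi => h i (hVj hi)]
  have hψ0 : ∀ y, X.avg V ψ y = 0 := fun y => by
    rw [hψdef, avg_sub, X.avg_avg hVj, X.avg_avg le_rfl, sub_self]
  have hB := hX.l2_avg_union_sub_avg_le hγ hjV hψ S hj
  simp only [hψ0, sub_zero] at hB
  have e1 : X.expect (fun x => ψ x * X.avg V φ x) = 0 := by
    have := X.expect_mul_avg (X.dependsOn_avg V φ) ψ
    simp only [hψ0, mul_zero, expect_const] at this
    rw [this]
    simp only [mul_comm]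
  have e2 : X.expect (fun x => ψ x ^ 2) = X.expect fun x => φ x * X.avg (V ∪ S) ψ x := by
    rw [X.expect_mul_avg (hφ.mono (by exact_mod_cast Finset.subset_union_right)) ψ]
    have h1 : X.expect (fun x => ψ x ^ 2) = X.expect (fun x => ψ x * X.avg (insert j V) φ x) -
        X.expect fun x => ψ x * X.avg V φ x := by
      rw [← expect_sub]
      congr 1
      funext x
      simp only [hψdef]
      ring
    rw [h1, e1, sub_zero, X.expect_mul_avg hψ]
    simp only [mul_comm]
  have h3 : X.l2 ψ ^ 2 ≤ X.l2 φ * (S.card * γ * X.l2 ψ) := by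
    rw [l2_sq, e2]
    exact (X.expect_mul_le _ _).trans (mul_le_mul_of_nonneg_left hB (X.l2_nonneg φ))
  have hS : (S.card : ℝ) ≤ d := by exact_mod_cast (Finset.card_le_univ S).trans (by simp)
  rcases (X.l2_nonneg ψ).eq_or_lt with h0 | h0
  · rw [← h0]; exact hpos
  · have h4 : X.l2 ψ ≤ S.card * γ * X.l2 φ := by
      refine le_of_mul_le_mul_right ?_ h0
      linarith
    exact h4.trans (by gcongr; exact X.l2_nonneg φ)

/-- On a `γ`-product, the conditional expectation given `x_U` of a function of `x_S` almost
only depends on `x_{U ∩ S}`. -/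
theorem IsGammaProduct.l2_avg_sub_avg_inter_le (hX : X.IsGammaProduct γ) (hγ : 0 ≤ γ)
    {S : Finset (Fin d)} {φ : (∀ i, Ω i) → ℝ} (hφ : DependsOn φ (S : Set (Fin d)))
    (U : Finset (Fin d)) :
    X.l2 (fun x => X.avg U φ x - X.avg (U ∩ S) φ x) ≤ d ^ 2 * γ * X.l2 φ := by
  classical
  have key : ∀ T : Finset (Fin d), Disjoint T S →
      X.l2 (fun x => X.avg (U ∩ S ∪ T) φ x - X.avg (U ∩ S) φ x) ≤
        T.card * (d * γ * X.l2 φ) := by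
    intro T
    induction T using Finset.induction_on with
    | empty => simp
    | insert s T hs ih =>
      intro hT
      rw [Finset.disjoint_insert_left] at hT
      have step := hX.l2_avg_insert_sub_avg_le_of_dependsOn hγ hφ hT.1 (U ∩ S ∪ T)
      have tri := X.l2_add_le
        (fun x => X.avg (insert s (U ∩ S ∪ T)) φ x - X.avg (U ∩ S ∪ T) φ x)
        (fun x => X.avg (U ∩ S ∪ T) φ x - X.avg (U ∩ S) φ x)
      simp only [sub_add_sub_cancel] at tri
      rw [Finset.card_insert_of_notMem hs, Finset.union_insert]
      push_cast
      linarith [ih hT.2]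
  have h := key (U \ S) Finset.sdiff_disjoint
  have hU : U ∩ S ∪ U \ S = U := by rw [Finset.union_comm, Finset.sdiff_union_inter]
  rw [hU] at h
  have hc : ((U \ S).card : ℝ) ≤ d := by exact_mod_cast (Finset.card_le_univ _).trans (by simp)
  calc _ ≤ ((U \ S).card : ℝ) * (d * γ * X.l2 φ) := h
    _ ≤ d * (d * γ * X.l2 φ) := by
        have := X.l2_nonneg φ
        gcongr
    _ = d ^ 2 * γ * X.l2 φ := by ring

end Decorrelation

/-! ### Alternating sums over subsets -/

section Alternating

variable {α : Type*} [DecidableEq α]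

lemma sum_powerset_union {M : Type*} [AddCommMonoid M] (U W : Finset α) (h : Disjoint U W)
    (φ : Finset α → M) :
    ∑ S ∈ (U ∪ W).powerset, φ S = ∑ B ∈ U.powerset, ∑ R ∈ W.powerset, φ (B ∪ R) := by
  induction W using Finset.induction_on generalizing φ with
  | empty => simp
  | insert s W hs ih =>
    rw [Finset.disjoint_insert_right] at h
    rw [Finset.union_insert, Finset.sum_powerset_insert (by simp [h.1, hs]), ih h.2, ih h.2,
      ← Finset.sum_add_distrib]
    refine Finset.sum_congr rfl fun B _ => ?_
    rw [Finset.sum_powerset_insert hs]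
    simp only [Finset.union_insert]

/-- The Möbius transform `S ↦ ∑_{T ⊆ S} (-1)^{|S ∖ T|} a(T)`. -/
def altSum (a : Finset α → ℝ) (S : Finset α) : ℝ :=
  ∑ T ∈ S.powerset, (-1) ^ (S \ T).card * a T

lemma altSum_insert (a : Finset α → ℝ) {s : α} {S : Finset α} (hs : s ∉ S) :
    altSum a (insert s S) = altSum (fun T => a (insert s T)) S - altSum a S := by
  rw [altSum, Finset.sum_powerset_insert hs, altSum, altSum, add_comm, sub_eq_add_neg,
    ← Finset.sum_neg_distrib]
  congr 1
  · refine Finset.sum_congr rfl fun T hT => ?_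
    rw [Finset.insert_sdiff_insert, Finset.sdiff_insert_of_notMem hs]
  · refine Finset.sum_congr rfl fun T hT => ?_
    have hsT : s ∉ T := fun h => hs (Finset.mem_powerset.1 hT h)
    rw [Finset.insert_sdiff_of_notMem _ hsT, Finset.card_insert_of_notMem (by simp [hs])]
    ring

/-- A weighted sum of Möbius transforms is an average over random sets `R`, in which every element
of `W` is kept with probability `θ`. -/
lemma sum_pow_mul_altSum (θ : ℝ) (B W : Finset α) (h : Disjoint B W) (a : Finset α → ℝ) :
    ∑ R ∈ W.powerset, θ ^ R.card * altSum a (B ∪ R) =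
      ∑ R ∈ W.powerset, θ ^ R.card * (1 - θ) ^ (W \ R).card *
        altSum (fun A => a (A ∪ R)) B := by
  induction W using Finset.induction_on generalizing a with
  | empty => simp
  | insert s W hs ih =>
    rw [Finset.disjoint_insert_right] at h
    rw [Finset.sum_powerset_insert hs, Finset.sum_powerset_insert hs]
    have e1 : ∑ R ∈ W.powerset, θ ^ (insert s R).card * altSum a (B ∪ insert s R) =
        θ * ∑ R ∈ W.powerset, θ ^ R.card * altSum (fun T => a (insert s T)) (B ∪ R) -
          θ * ∑ R ∈ W.powerset, θ ^ R.card * altSum a (B ∪ R) := by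
      rw [← mul_sub, ← Finset.sum_sub_distrib, Finset.mul_sum]
      refine Finset.sum_congr rfl fun R hR => ?_
      have hsR : s ∉ R := fun h' => hs (Finset.mem_powerset.1 hR h')
      rw [Finset.card_insert_of_notMem hsR, Finset.union_insert,
        altSum_insert _ (by simp [h.1, hsR])]
      ring
    have e2 : ∑ R ∈ W.powerset, θ ^ R.card * (1 - θ) ^ (insert s W \ R).card *
        altSum (fun A => a (A ∪ R)) B = (1 - θ) *
        ∑ R ∈ W.powerset, θ ^ R.card * (1 - θ) ^ (W \ R).card * altSum (fun A => a (A ∪ R)) B := by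
      rw [Finset.mul_sum]
      refine Finset.sum_congr rfl fun R hR => ?_
      have hsR : s ∉ R := fun h' => hs (Finset.mem_powerset.1 hR h')
      rw [Finset.insert_sdiff_of_notMem _ hsR, Finset.card_insert_of_notMem (by simp [hs])]
      ring
    have e3 : ∑ R ∈ W.powerset, θ ^ (insert s R).card * (1 - θ) ^ (insert s W \ insert s R).card *
        altSum (fun A => a (A ∪ insert s R)) B = θ *
        ∑ R ∈ W.powerset, θ ^ R.card * (1 - θ) ^ (W \ R).card *
          altSum (fun A => a (insert s (A ∪ R))) B := by
      rw [Finset.mul_sum]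
      refine Finset.sum_congr rfl fun R hR => ?_
      have hsR : s ∉ R := fun h' => hs (Finset.mem_powerset.1 hR h')
      rw [Finset.insert_sdiff_insert, Finset.sdiff_insert_of_notMem hs,
        Finset.card_insert_of_notMem hsR]
      simp only [Finset.union_insert]
      ring
    rw [e1, e2, e3, ih h.2, ih h.2]
    ring

lemma sum_powerset_pow_card (x : ℝ) (S : Finset α) :
    ∑ T ∈ S.powerset, x ^ T.card = (1 + x) ^ S.card := by
  rw [add_comm, ← Finset.prod_const, Finset.prod_add]
  simp

lemma sum_powerset_bernoulli (θ : ℝ) (W : Finset α) :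
    ∑ R ∈ W.powerset, θ ^ R.card * (1 - θ) ^ (W \ R).card = 1 := by
  have := Finset.prod_add (fun _ => θ) (fun _ => 1 - θ) W
  simpa using this.symm

end Alternating

/-! ### Efron–Stein components -/

section Components

variable {d : ℕ} {Ω : Fin d → Type u} [∀ i, Fintype (Ω i)] (X : PartiteComplex Ω)

/-- The Efron–Stein component `f^{=S} = ∑_{T ⊆ S} (-1)^{|S ∖ T|} E_T f`, multiplied by `θ^{|S|}`;
it is the component of `T_θ f` at `S`. -/
def component (θ : ℝ) (f : (∀ i, Ω i) → ℝ) (S : Finset (Fin d)) : (∀ i, Ω i) → ℝ :=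
  fun x => θ ^ S.card * altSum (fun T => X.avg T f x) S

lemma dependsOn_component (θ : ℝ) (f : (∀ i, Ω i) → ℝ) (S : Finset (Fin d)) :
    DependsOn (X.component θ f S) (S : Set (Fin d)) := by
  intro x y h
  rw [component, component]
  congr 1
  refine Finset.sum_congr rfl fun T hT => ?_
  dsimp only
  rw [X.dependsOn_avg T f fun i hi => h i (Finset.mem_powerset.1 hT hi)]

lemma component_mul (σ θ : ℝ) (f : (∀ i, Ω i) → ℝ) (S : Finset (Fin d)) (x : ∀ i, Ω i) :
    X.component (σ * θ) f S x = σ ^ S.card * X.component θ f S x := by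
  rw [component, component, mul_pow]
  ring

/-- The noise operator multiplies the component at `S` by `ρ^{|S|}`. -/
lemma noise_eq_sum_component (ρ : ℝ) (f : (∀ i, Ω i) → ℝ) (x : ∀ i, Ω i) :
    X.noise ρ f x = ∑ S, X.component ρ f S x := by
  have h := sum_pow_mul_altSum ρ ∅ (Finset.univ : Finset (Fin d)) (by simp)
    fun T => X.avg T f x
  simp only [Finset.powerset_univ, Finset.empty_union] at h
  simp only [component, noise, h]
  refine Finset.sum_congr rfl fun S _ => ?_
  simp [altSum, ← Finset.compl_eq_univ_sdiff, Finset.card_compl]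

/-- The part of `T_θ f` whose components meet `U = Wᶜ` exactly in `B`. Only the factor `θ^{|B|}` and
a probability distribution over the subsets `R` of `W` remain of the weights. -/
lemma sum_component_union (θ : ℝ) (f : (∀ i, Ω i) → ℝ) {B W : Finset (Fin d)}
    (h : Disjoint B W) (x : ∀ i, Ω i) :
    ∑ R ∈ W.powerset, X.component θ f (B ∪ R) x =
      θ ^ B.card * ∑ R ∈ W.powerset, θ ^ R.card * (1 - θ) ^ (W \ R).card *
        altSum (fun A => X.avg (A ∪ R) f x) B := by
  rw [← sum_pow_mul_altSum θ B W h fun T => X.avg T f x, Finset.mul_sum]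
  refine Finset.sum_congr rfl fun R hR => ?_
  rw [component, Finset.card_union_of_disjoint (h.mono_right (Finset.mem_powerset.1 hR)), pow_add,
    mul_assoc]

variable {X} {γ r θ : ℝ} {f : (∀ i, Ω i) → ℝ}

lemma IsGlobal.avg_sq_le (hf : X.IsGlobal r f) (S : Finset (Fin d)) {y : ∀ i, Ω i}
    (hy : 0 < X.weight y) :
    X.avg S (fun x => f x ^ 2) y ≤ (r ^ S.card * X.l2 f) ^ 2 := by
  have h := hf S (proj S y) (X.isFace_proj S hy)
  rw [pNorm_two_eq_l2, pNorm_two_eq_l2] at h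
  rw [← X.l2_link_sq y (X.isFace_proj S hy)]
  exact pow_le_pow_left₀ (l2_nonneg _ _) h 2

lemma IsGlobal.abs_avg_le (hf : X.IsGlobal r f) (hr : 0 ≤ r) (S : Finset (Fin d))
    {y : ∀ i, Ω i} (hy : 0 < X.weight y) : |X.avg S f y| ≤ r ^ S.card * X.l2 f :=
  abs_le_of_sq_le_sq ((X.sq_avg_le S f y).trans (hf.avg_sq_le S hy))
    (mul_nonneg (pow_nonneg hr _) (X.l2_nonneg f))

/-- At noise rate `1 / r` the components of an `r`-global function are bounded. -/
lemma IsGlobal.abs_component_le (hf : X.IsGlobal r f) (hr : 1 ≤ r) (hθ : 0 ≤ θ) (hθr : θ * r = 1)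
    (S : Finset (Fin d)) {y : ∀ i, Ω i} (hy : 0 < X.weight y) :
    |X.component θ f S y| ≤ 2 ^ S.card * X.l2 f := by
  rw [component, abs_mul, abs_of_nonneg (pow_nonneg hθ _), altSum]
  have h1 : ∀ T ∈ S.powerset, |(-1) ^ (S \ T).card * X.avg T f y| ≤ r ^ S.card * X.l2 f := by
    intro T hT
    rw [abs_mul, abs_pow, abs_neg, abs_one, one_pow, one_mul]
    refine (hf.abs_avg_le (by linarith) T hy).trans ?_
    have := X.l2_nonneg f
    gcongr
    exact Finset.mem_powerset.1 hT
  have h2 := (Finset.abs_sum_le_sum_abs _ _).trans (Finset.sum_le_sum h1)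
  rw [Finset.sum_const, Finset.card_powerset, nsmul_eq_mul] at h2
  calc _ ≤ θ ^ S.card * (((2 ^ S.card : ℕ) : ℝ) * (r ^ S.card * X.l2 f)) := by gcongr
    _ = (θ * r) ^ S.card * (2 ^ S.card * X.l2 f) := by push_cast; ring
    _ = _ := by rw [hθr, one_pow, one_mul]

/-- Averaging over a coordinate of `S` almost annihilates the component at `S`. -/
lemma IsGammaProduct.l2_avg_compl_component_le (hX : X.IsGammaProduct γ) (hγ : 0 ≤ γ)
    (hθ : 0 ≤ θ) (hθ1 : θ ≤ 1) (f : (∀ i, Ω i) → ℝ) {i : Fin d} {S : Finset (Fin d)}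
    (hi : i ∈ S) :
    X.l2 (X.avg {i}ᶜ (X.component θ f S)) ≤ 2 ^ d * (d ^ 2 * γ) * X.l2 f := by
  obtain ⟨S, hiS, rfl⟩ : ∃ S', i ∉ S' ∧ insert i S' = S :=
    ⟨S.erase i, Finset.notMem_erase _ _, Finset.insert_erase hi⟩
  have hpow : θ ^ (insert i S).card ≤ 1 := pow_le_one₀ hθ hθ1
  have hterm : ∀ T ∈ S.powerset, X.l2 (fun x => (-1) ^ (S \ T).card *
      (X.avg {i}ᶜ (X.avg (insert i T) f) x - X.avg T (X.avg (insert i T) f) x)) ≤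
        d ^ 2 * γ * X.l2 f := by
    intro T hT
    have hiT : i ∉ T := fun h => hiS (Finset.mem_powerset.1 hT h)
    have h := hX.l2_avg_sub_avg_inter_le hγ (X.dependsOn_avg (insert i T) f) {i}ᶜ
    have hT' : ({i}ᶜ : Finset (Fin d)) ∩ insert i T = T := by
      ext j
      simp only [Finset.mem_inter, Finset.mem_compl, Finset.mem_singleton, Finset.mem_insert]
      constructor
      · tauto
      · exact fun hj => ⟨fun h => hiT (h ▸ hj), Or.inr hj⟩
    rw [hT'] at h
    rw [l2_const_mul, abs_pow, abs_neg, abs_one, one_pow, one_mul]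
    exact h.trans (mul_le_mul_of_nonneg_left (X.l2_avg_le _ f) (by positivity))
  have hsum : X.l2 (X.avg {i}ᶜ (X.component θ f (insert i S))) =
      θ ^ (insert i S).card * X.l2 (fun x => ∑ T ∈ S.powerset, (-1) ^ (S \ T).card *
        (X.avg {i}ᶜ (X.avg (insert i T) f) x - X.avg T (X.avg (insert i T) f) x)) := by
    rw [← abs_of_nonneg (pow_nonneg hθ (insert i S).card)]
    rw [← l2_const_mul]
    refine X.l2_congr fun x hx => ?_
    have e : X.component θ f (insert i S) = fun x => θ ^ (insert i S).card *
        ∑ T ∈ S.powerset, (-1) ^ (S \ T).card * (X.avg (insert i T) f x - X.avg T f x) := by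
      funext z
      rw [component, altSum_insert _ hiS, altSum, altSum, ← Finset.sum_sub_distrib]
      simp only [mul_sub]
    rw [e, avg_const_mul, avg_sum]
    congr 1
    refine Finset.sum_congr rfl fun T hT => ?_
    have hiT : i ∉ T := fun h => hiS (Finset.mem_powerset.1 hT h)
    rw [avg_const_mul, avg_sub, X.avg_avg (Finset.subset_insert i T)]
    congr 2
    refine X.avg_eq_self ((X.dependsOn_avg T f).mono ?_) hx
    intro j hj
    simp only [Finset.coe_compl, Finset.coe_singleton, Set.mem_compl_iff, Set.mem_singleton_iff]
    rintro rfl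
    exact hiT hj
  rw [hsum]
  calc _ ≤ 1 * X.l2 (fun x => ∑ T ∈ S.powerset, (-1) ^ (S \ T).card *
        (X.avg {i}ᶜ (X.avg (insert i T) f) x - X.avg T (X.avg (insert i T) f) x)) :=
        mul_le_mul_of_nonneg_right hpow (X.l2_nonneg _)
    _ ≤ ∑ T ∈ S.powerset, d ^ 2 * γ * X.l2 f := by
        rw [one_mul]
        exact (X.l2_sum_le _ _).trans (Finset.sum_le_sum hterm)
    _ = 2 ^ S.card * (d ^ 2 * γ) * X.l2 f := by
        rw [Finset.sum_const, Finset.card_powerset, nsmul_eq_mul]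
        push_cast
        ring
    _ ≤ _ := by
        have := X.l2_nonneg f
        gcongr
        · exact one_le_two
        · exact (Finset.card_le_univ S).trans (by simp)

end Components

/-! ### Moments of the square function -/

section Moments

variable {d : ℕ} {Ω : Fin d → Type u} [∀ i, Fintype (Ω i)] {X : PartiteComplex Ω}
  {γ r θ b : ℝ} {f P : (∀ i, Ω i) → ℝ} {U : Finset (Fin d)}

lemma expect_mul_le_of_abs_le {P g : (∀ i, Ω i) → ℝ} (hP : ∀ x, 0 < X.weight x → |P x| ≤ b)
    (hb : 0 ≤ b) : X.expect (fun x => P x * g x) ≤ b * X.l2 g := by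
  calc X.expect (fun x => P x * g x) ≤ X.expect fun x => b * |g x| :=
        X.expect_mono fun x hx => (le_abs_self _).trans <| by
          rw [abs_mul]
          exact mul_le_mul_of_nonneg_right (hP x hx) (abs_nonneg _)
    _ = b * X.expect fun x => |g x| := X.expect_const_mul _ _
    _ ≤ b * X.l2 g := mul_le_mul_of_nonneg_left (X.expect_abs_le_l2 g) hb

/-- Against a weight `P(x_U)`, the square of `E_{A ∪ R} f` with `A ⊆ U` and `R` disjoint from `U`
is bounded through globalness at `A` only. The coordinates of `R` enter just the error
term, and there only to the first power of `r ^ |R|`. -/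
lemma expect_mul_avg_sq_le (hX : X.IsGammaProduct γ) (hγ : 0 ≤ γ) (hf : X.IsGlobal r f)
    (hr : 1 ≤ r) (hf1 : X.l2 f = 1) (hP : DependsOn P (U : Set (Fin d)))
    (hP0 : ∀ x, 0 < X.weight x → 0 ≤ P x) (hPb : ∀ x, 0 < X.weight x → P x ≤ b) (hb : 0 ≤ b)
    {A R : Finset (Fin d)} (hA : A ⊆ U) (hR : Disjoint U R) :
    X.expect (fun x => P x * X.avg (A ∪ R) f x ^ 2) ≤
      r ^ (2 * A.card) * X.expect P + b * (d ^ 2 * γ * r ^ (A.card + R.card)) := by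
  have hr0 : 0 ≤ r := by linarith
  have hUA : U ∩ (A ∪ R) = A := by
    rw [Finset.inter_union_distrib_left, Finset.disjoint_iff_inter_eq_empty.1 hR,
      Finset.union_empty, Finset.inter_eq_right.2 hA]
  have hcard : (A ∪ R).card = A.card + R.card := Finset.card_union_of_disjoint (hR.mono_left hA)
  set φ : (∀ i, Ω i) → ℝ := fun x => X.avg (A ∪ R) f x ^ 2 with hφ
  have hφdep : DependsOn φ ((A ∪ R : Finset (Fin d)) : Set (Fin d)) := fun x y h => by
    simp only [hφ]
    rw [X.dependsOn_avg _ f h]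
  have hφl2 : X.l2 φ ≤ r ^ (A.card + R.card) := by
    refine X.l2_le_of_sq_le (pow_nonneg hr0 _) ?_
    have h1 : X.expect (fun x => φ x ^ 2) ≤
        X.expect fun x => (r ^ (A.card + R.card)) ^ 2 * X.avg (A ∪ R) f x ^ 2 := by
      refine X.expect_mono fun x hx => ?_
      simp only [hφ]
      rw [sq (X.avg (A ∪ R) f x ^ 2)]
      refine mul_le_mul_of_nonneg_right ?_ (sq_nonneg _)
      have h := hf.abs_avg_le hr0 (A ∪ R) hx
      rw [hf1, mul_one, hcard] at h
      rw [← sq_abs]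
      exact pow_le_pow_left₀ (abs_nonneg _) h 2
    refine h1.trans ?_
    rw [expect_const_mul, ← l2_sq]
    refine mul_le_of_le_one_right (by positivity) (pow_le_one₀ (X.l2_nonneg _) ?_)
    rw [← hf1]
    exact X.l2_avg_le _ f
  have hdec := hX.l2_avg_sub_avg_inter_le hγ hφdep U
  rw [hUA] at hdec
  have hmain : X.expect (fun x => P x * X.avg A φ x) ≤ r ^ (2 * A.card) * X.expect P := by
    rw [← expect_const_mul]
    refine X.expect_mono fun x hx => ?_
    rw [mul_comm]
    refine mul_le_mul_of_nonneg_right ?_ (hP0 x hx)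
    calc X.avg A φ x ≤ X.avg A (X.avg (A ∪ R) fun z => f z ^ 2) x :=
          X.avg_mono (fun z _ => X.sq_avg_le _ f z) x
      _ = X.avg A (fun z => f z ^ 2) x := X.avg_avg Finset.subset_union_left _ x
      _ ≤ _ := hf.avg_sq_le A hx
      _ = r ^ (2 * A.card) := by rw [hf1, mul_one, ← pow_mul, mul_comm]
  have herr : X.expect (fun x => P x * (X.avg U φ x - X.avg A φ x)) ≤
      b * (d ^ 2 * γ * r ^ (A.card + R.card)) := by
    refine (expect_mul_le_of_abs_le (b := b) (fun x hx => ?_) hb).trans ?_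
    · rw [abs_of_nonneg (hP0 x hx)]; exact hPb x hx
    · gcongr
      exact hdec.trans (by gcongr)
  calc X.expect (fun x => P x * φ x) = X.expect (fun x => P x * X.avg U φ x) :=
        (X.expect_mul_avg hP φ).symm
    _ = X.expect (fun x => P x * X.avg A φ x) +
          X.expect fun x => P x * (X.avg U φ x - X.avg A φ x) := by
        rw [← expect_add]
        congr 1
        funext x
        ring
    _ ≤ _ := add_le_add hmain herr

/-- Approximate orthogonality of components that differ outside `U`, against a weight `P(x_U)`. -/
lemma abs_expect_mul_component_mul_component_le (hX : X.IsGammaProduct γ) (hγ : 0 ≤ γ)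
    (hf : X.IsGlobal r f) (hr : 1 ≤ r) (hθ : 0 ≤ θ) (hθr : θ * r = 1) (hf1 : X.l2 f = 1)
    (hP : DependsOn P (U : Set (Fin d))) (hPb : ∀ x, 0 < X.weight x → |P x| ≤ b) (hb : 0 ≤ b)
    {S T : Finset (Fin d)} {i : Fin d} (hiS : i ∈ S) (hiT : i ∉ T) (hiU : i ∉ U) :
    |X.expect fun x => P x * (X.component θ f S x * X.component θ f T x)| ≤
      b * (4 ^ d * (d ^ 2 * γ)) := by
  have hθ1 : θ ≤ 1 := by nlinarith
  have hdep : ∀ s : ℝ, DependsOn (fun x => s * (P x * X.component θ f T x))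
      (({i}ᶜ : Finset (Fin d)) : Set (Fin d)) := by
    intro s x y h
    have h1 : P x = P y := hP fun j hj => h j (by
      simp only [Finset.coe_compl, Finset.coe_singleton, Set.mem_compl_iff, Set.mem_singleton_iff]
      rintro rfl; exact hiU hj)
    have h2 : X.component θ f T x = X.component θ f T y := X.dependsOn_component θ f T fun j hj =>
      h j (by
        simp only [Finset.coe_compl, Finset.coe_singleton, Set.mem_compl_iff,
          Set.mem_singleton_iff]
        rintro rfl; exact hiT hj)
    simp only [h1, h2]
  have key : ∀ s : ℝ, |s| = 1 →
      s * X.expect (fun x => P x * (X.component θ f S x * X.component θ f T x)) ≤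
        b * (4 ^ d * (d ^ 2 * γ)) := by
    intro s hs
    have e : s * X.expect (fun x => P x * (X.component θ f S x * X.component θ f T x)) =
        X.expect fun x => (s * (P x * X.component θ f T x)) *
          X.avg {i}ᶜ (X.component θ f S) x := by
      rw [X.expect_mul_avg (hdep s), ← expect_const_mul]
      congr 1
      funext x
      ring
    rw [e]
    refine (expect_mul_le_of_abs_le (b := b * 2 ^ d) (fun x hx => ?_) (by positivity)).trans ?_
    · rw [abs_mul, hs, one_mul, abs_mul]
      have h1 := hf.abs_component_le hr hθ hθr T hx
      rw [hf1, mul_one] at h1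
      refine mul_le_mul (hPb x hx) (h1.trans ?_) (abs_nonneg _) hb
      exact pow_le_pow_right₀ one_le_two ((Finset.card_le_univ T).trans (by simp))
    · have h2 := hX.l2_avg_compl_component_le hγ hθ hθ1 f hiS
      rw [hf1, mul_one] at h2
      calc b * 2 ^ d * X.l2 (X.avg {i}ᶜ (X.component θ f S))
          ≤ b * 2 ^ d * (2 ^ d * (d ^ 2 * γ)) := by gcongr
        _ = b * (4 ^ d * (d ^ 2 * γ)) := by
          rw [show (4 : ℝ) = 2 * 2 by norm_num, mul_pow]
          ring
  rw [abs_le']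
  exact ⟨by simpa using key 1 (by simp), by simpa using key (-1) (by simp)⟩

/-- The components that meet `U` exactly in `B` carry, against a weight `P(x_U)`, a mass of at most
`4 ^ |B|`, up to a small error. -/
lemma expect_mul_sq_sum_component_le (hX : X.IsGammaProduct γ) (hγ : 0 ≤ γ) (hf : X.IsGlobal r f)
    (hr : 1 ≤ r) (hθ : 0 ≤ θ) (hθr : θ * r = 1) (hf1 : X.l2 f = 1)
    (hP : DependsOn P (U : Set (Fin d))) (hP0 : ∀ x, 0 < X.weight x → 0 ≤ P x)
    (hPb : ∀ x, 0 < X.weight x → P x ≤ b) (hb : 0 ≤ b) {B W : Finset (Fin d)} (hB : B ⊆ U)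
    (hW : Disjoint U W) :
    X.expect (fun x => P x * (∑ R ∈ W.powerset, X.component θ f (B ∪ R) x) ^ 2) ≤
      4 ^ B.card * X.expect P + b * (8 ^ d * (d ^ 2 * γ)) := by
  have hr0 : 0 ≤ r := by linarith
  have hθ1 : θ ≤ 1 := by nlinarith
  have hEP : 0 ≤ X.expect P := X.expect_nonneg hP0
  set ν : Finset (Fin d) → ℝ := fun R => θ ^ R.card * (1 - θ) ^ (W \ R).card with hν
  have hν0 : ∀ R, 0 ≤ ν R := fun R => mul_nonneg (pow_nonneg hθ _) (pow_nonneg (by linarith) _)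
  have hν1 : ∑ R ∈ W.powerset, ν R = 1 := sum_powerset_bernoulli θ W
  have hνr : ∀ R, ν R * r ^ R.card ≤ 1 := fun R => by
    calc ν R * r ^ R.card = (θ * r) ^ R.card * (1 - θ) ^ (W \ R).card := by
          simp only [hν, mul_pow]; ring
      _ ≤ 1 := by
          rw [hθr, one_pow, one_mul]
          exact pow_le_one₀ (by linarith) (by linarith)
  -- Two applications of Cauchy–Schwarz: over the random set `R` and over the subsets of `B`.
  have hpt : ∀ x, (∑ R ∈ W.powerset, X.component θ f (B ∪ R) x) ^ 2 ≤
      (θ ^ B.card) ^ 2 * ∑ R ∈ W.powerset, ν R *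
        (2 ^ B.card * ∑ A ∈ B.powerset, X.avg (A ∪ R) f x ^ 2) := by
    intro x
    rw [X.sum_component_union θ f (hW.mono_left hB), mul_pow]
    refine mul_le_mul_of_nonneg_left ?_ (sq_nonneg _)
    have h1 : (∑ R ∈ W.powerset, ν R * altSum (fun A => X.avg (A ∪ R) f x) B) ^ 2 ≤
        (∑ R ∈ W.powerset, ν R) *
          ∑ R ∈ W.powerset, ν R * altSum (fun A => X.avg (A ∪ R) f x) B ^ 2 :=
      Finset.sum_sq_le_sum_mul_sum_of_sq_le_mul _ (fun R _ => hν0 R)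
        (fun R _ => mul_nonneg (hν0 R) (sq_nonneg _)) (fun R _ => le_of_eq (by ring))
    rw [hν1, one_mul] at h1
    refine h1.trans (Finset.sum_le_sum fun R _ => mul_le_mul_of_nonneg_left ?_ (hν0 R))
    have h2 := sq_sum_le_card_mul_sum_sq (s := B.powerset)
      (f := fun A => (-1 : ℝ) ^ (B \ A).card * X.avg (A ∪ R) f x)
    rw [Finset.card_powerset] at h2
    push_cast at h2
    refine h2.trans (le_of_eq ?_)
    congr 1
    refine Finset.sum_congr rfl fun A _ => ?_
    rw [mul_pow, ← pow_mul, mul_comm _ 2, pow_mul, neg_one_sq, one_pow, one_mul]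
  have hint : ∀ R ∈ W.powerset, ∀ A ∈ B.powerset,
      X.expect (fun x => P x * X.avg (A ∪ R) f x ^ 2) ≤
        r ^ (2 * B.card) * (X.expect P + b * (d ^ 2 * γ) * r ^ R.card) := by
    intro R hR A hA
    rw [Finset.mem_powerset] at hR hA
    refine (expect_mul_avg_sq_le hX hγ hf hr hf1 hP hP0 hPb hb (hA.trans hB)
      (hW.mono_right hR)).trans ?_
    have hAB := Finset.card_le_card hA
    have e1 : r ^ (2 * A.card) ≤ r ^ (2 * B.card) := pow_le_pow_right₀ hr (by omega)
    have e2 : r ^ A.card ≤ r ^ (2 * B.card) := pow_le_pow_right₀ hr (by omega)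
    calc _ = r ^ (2 * A.card) * X.expect P + r ^ A.card * (b * (d ^ 2 * γ) * r ^ R.card) := by
          rw [pow_add]; ring
      _ ≤ r ^ (2 * B.card) * X.expect P + r ^ (2 * B.card) * (b * (d ^ 2 * γ) * r ^ R.card) := by
          gcongr
      _ = _ := by ring
  calc X.expect (fun x => P x * (∑ R ∈ W.powerset, X.component θ f (B ∪ R) x) ^ 2)
      ≤ X.expect fun x => (θ ^ B.card) ^ 2 * ∑ R ∈ W.powerset, ν R *
        (2 ^ B.card * ∑ A ∈ B.powerset, P x * X.avg (A ∪ R) f x ^ 2) := by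
        refine X.expect_mono fun x hx => ?_
        refine (mul_le_mul_of_nonneg_left (hpt x) (hP0 x hx)).trans (le_of_eq ?_)
        simp only [Finset.mul_sum]
        refine Finset.sum_congr rfl fun R _ => Finset.sum_congr rfl fun A _ => ?_
        ring
    _ = (θ ^ B.card) ^ 2 * ∑ R ∈ W.powerset, ν R *
        (2 ^ B.card * ∑ A ∈ B.powerset, X.expect fun x => P x * X.avg (A ∪ R) f x ^ 2) := by
        simp only [expect_const_mul, expect_sum]
    _ ≤ (θ ^ B.card) ^ 2 * ∑ R ∈ W.powerset, ν R *
        (2 ^ B.card * ∑ A ∈ B.powerset,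
          r ^ (2 * B.card) * (X.expect P + b * (d ^ 2 * γ) * r ^ R.card)) := by
        gcongr with R hR A hA
        exact hint R hR A hA
    _ = ((θ * r) ^ B.card) ^ 2 * 4 ^ B.card * ((∑ R ∈ W.powerset, ν R) * X.expect P +
          b * (d ^ 2 * γ) * ∑ R ∈ W.powerset, ν R * r ^ R.card) := by
        simp only [Finset.sum_const, Finset.card_powerset, nsmul_eq_mul]
        rw [Finset.sum_mul, Finset.mul_sum, Finset.mul_sum, ← Finset.sum_add_distrib,
          Finset.mul_sum]
        refine Finset.sum_congr rfl fun R _ => ?_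
        push_cast
        have h4 : (4 : ℝ) ^ B.card = 2 ^ B.card * 2 ^ B.card := by rw [← mul_pow]; norm_num
        rw [h4, mul_pow]
        ring
    _ ≤ 4 ^ B.card * (X.expect P + b * (d ^ 2 * γ) * 2 ^ d) := by
        rw [hθr, one_pow, one_pow, one_mul, hν1, one_mul]
        gcongr
        calc ∑ R ∈ W.powerset, ν R * r ^ R.card ≤ ∑ R ∈ W.powerset, (1 : ℝ) :=
              Finset.sum_le_sum fun R _ => hνr R
          _ = 2 ^ W.card := by simp
          _ ≤ 2 ^ d := pow_le_pow_right₀ one_le_two ((Finset.card_le_univ W).trans (by simp))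
    _ ≤ 4 ^ B.card * X.expect P + b * (8 ^ d * (d ^ 2 * γ)) := by
        have h4 : (4 : ℝ) ^ B.card ≤ 4 ^ d :=
          pow_le_pow_right₀ (by norm_num) ((Finset.card_le_univ B).trans (by simp))
        have h8 : (8 : ℝ) ^ d = 4 ^ d * 2 ^ d := by rw [← mul_pow]; norm_num
        rw [mul_add, h8]
        have := mul_le_mul_of_nonneg_right h4
          (show 0 ≤ b * (d ^ 2 * γ) * 2 ^ d by positivity)
        linarith

/-- Integrating out one factor `∑_S w^{|S|} h_S²` of a product of square functions, where `h_S` are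
the components, costs at most `1 + 4w` for every coordinate that the other factors depend on. -/
lemma expect_mul_squareFunction_le (hX : X.IsGammaProduct γ) (hγ : 0 ≤ γ) (hf : X.IsGlobal r f)
    (hr : 1 ≤ r) (hθ : 0 ≤ θ) (hθr : θ * r = 1) (hf1 : X.l2 f = 1)
    (hP : DependsOn P (U : Set (Fin d))) (hP0 : ∀ x, 0 < X.weight x → 0 ≤ P x)
    (hPb : ∀ x, 0 < X.weight x → P x ≤ b) (hb : 0 ≤ b) {w : ℝ} (hw : 0 ≤ w) (hw1 : w ≤ 1) :
    X.expect (fun x => P x * ∑ S, w ^ S.card * X.component θ f S x ^ 2) ≤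
      (1 + 4 * w) ^ U.card * X.expect P + b * (2 * 32 ^ d * (d ^ 2 * γ)) := by
  set W : Finset (Fin d) := Uᶜ with hWdef
  have hUW : Disjoint U W := disjoint_compl_right
  have hcompl : U ∪ W = Finset.univ := Finset.union_compl U
  have hPabs : ∀ x, 0 < X.weight x → |P x| ≤ b := fun x hx => by
    rw [abs_of_nonneg (hP0 x hx)]; exact hPb x hx
  set h : Finset (Fin d) → (∀ i, Ω i) → ℝ := X.component θ f with hh
  have hWcard : (2 : ℝ) ^ W.card ≤ 2 ^ d :=
    pow_le_pow_right₀ one_le_two ((Finset.card_le_univ W).trans (by simp))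
  have hEnn : ∀ S, 0 ≤ X.expect fun x => P x * h S x ^ 2 := fun S =>
    X.expect_nonneg fun x hx => mul_nonneg (hP0 x hx) (sq_nonneg _)
  have hblock : ∀ B ∈ U.powerset, ∑ R ∈ W.powerset, X.expect (fun x => P x * h (B ∪ R) x ^ 2) ≤
      4 ^ B.card * X.expect P + b * (2 * 16 ^ d * (d ^ 2 * γ)) := by
    intro B hB
    rw [Finset.mem_powerset] at hB
    have hpair : ∀ R ∈ W.powerset, ∀ R' ∈ W.powerset,
        (if R = R' then X.expect (fun x => P x * h (B ∪ R) x ^ 2) else 0) -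
          X.expect (fun x => P x * (h (B ∪ R) x * h (B ∪ R') x)) ≤
          b * (4 ^ d * (d ^ 2 * γ)) := by
      intro R hR R' hR'
      rw [Finset.mem_powerset] at hR hR'
      split_ifs with hRR
      · subst hRR
        simp only [sq, sub_self]
        positivity
      · rw [zero_sub]
        have hout : ∀ Q Q' : Finset (Fin d), Q ⊆ W → ∀ i ∈ Q, i ∉ Q' → i ∉ B ∪ Q' ∧ i ∉ U := by
          intro Q Q' hQ i hi hi'
          have hiU : i ∉ U := Finset.mem_compl.1 (hQ hi)
          exact ⟨Finset.notMem_union.2 ⟨fun h' => hiU (hB h'), hi'⟩, hiU⟩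
        obtain ⟨i, hi⟩ : ∃ i, ¬ (i ∈ R ↔ i ∈ R') := by
          by_contra! hcon
          exact hRR (Finset.ext hcon)
        by_cases hiR : i ∈ R
        · have hiR' : i ∉ R' := fun h' => hi ⟨fun _ => h', fun _ => hiR⟩
          obtain ⟨h1, h2⟩ := hout R R' hR i hiR hiR'
          exact (neg_le_abs _).trans (abs_expect_mul_component_mul_component_le hX hγ hf hr hθ hθr
            hf1 hP hPabs hb (Finset.mem_union_right B hiR) h1 h2)
        · have hiR' : i ∈ R' := by tauto
          obtain ⟨h1, h2⟩ := hout R' R hR' i hiR' hiR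
          refine (neg_le_abs _).trans ?_
          simp only [mul_comm (h (B ∪ R) _)]
          exact abs_expect_mul_component_mul_component_le hX hγ hf hr hθ hθr
            hf1 hP hPabs hb (Finset.mem_union_right B hiR') h1 h2
    have hsum := Finset.sum_le_sum fun R hR => Finset.sum_le_sum (hpair R hR)
    simp only [Finset.sum_sub_distrib, Finset.sum_const, Finset.card_powerset, nsmul_eq_mul,
      Finset.sum_ite_eq] at hsum
    rw [Finset.sum_congr rfl (g := fun R => X.expect (fun x => P x * h (B ∪ R) x ^ 2))
      (fun R hR => if_pos hR)] at hsum
    have hsq : ∑ R ∈ W.powerset, ∑ R' ∈ W.powerset,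
        X.expect (fun x => P x * (h (B ∪ R) x * h (B ∪ R') x)) =
        X.expect fun x => P x * (∑ R ∈ W.powerset, h (B ∪ R) x) ^ 2 := by
      simp only [← expect_sum, ← Finset.mul_sum, sq, ← Finset.sum_mul]
    have hB' := expect_mul_sq_sum_component_le hX hγ hf hr hθ hθr hf1 hP hP0 hPb hb hB hUW
    have hη : 0 ≤ b * (d ^ 2 * γ) := by positivity
    have herr : ((2 ^ W.card : ℕ) : ℝ) * (((2 ^ W.card : ℕ) : ℝ) * (b * (4 ^ d * (d ^ 2 * γ)))) ≤
        b * (16 ^ d * (d ^ 2 * γ)) := by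
      push_cast
      calc _ ≤ (2 : ℝ) ^ d * (2 ^ d * (b * (4 ^ d * (d ^ 2 * γ)))) := by gcongr
        _ = b * ((2 * 2 * 4) ^ d * (d ^ 2 * γ)) := by rw [mul_pow, mul_pow]; ring
        _ = _ := by norm_num
    have h816 : b * (8 ^ d * (d ^ 2 * γ)) ≤ b * (16 ^ d * (d ^ 2 * γ)) := by
      gcongr
      norm_num
    rw [hsq] at hsum
    linarith
  calc X.expect (fun x => P x * ∑ S, w ^ S.card * h S x ^ 2)
      = ∑ S, w ^ S.card * X.expect fun x => P x * h S x ^ 2 := by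
        simp only [Finset.mul_sum, expect_sum, ← expect_const_mul]
        refine Finset.sum_congr rfl fun S _ => ?_
        congr 1
        funext x
        ring
    _ = ∑ B ∈ U.powerset, ∑ R ∈ W.powerset,
          w ^ (B ∪ R).card * X.expect fun x => P x * h (B ∪ R) x ^ 2 := by
        rw [← sum_powerset_union U W hUW fun S => w ^ S.card * X.expect fun x => P x * h S x ^ 2,
          hcompl, Finset.powerset_univ]
    _ ≤ ∑ B ∈ U.powerset, w ^ B.card *
          (4 ^ B.card * X.expect P + b * (2 * 16 ^ d * (d ^ 2 * γ))) := by
        refine Finset.sum_le_sum fun B hB => ?_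
        refine le_trans ?_ (mul_le_mul_of_nonneg_left (hblock B hB) (pow_nonneg hw _))
        rw [Finset.mul_sum]
        refine Finset.sum_le_sum fun R _ => mul_le_mul_of_nonneg_right ?_ (hEnn _)
        exact pow_le_pow_of_le_one hw hw1 (Finset.card_le_card Finset.subset_union_left)
    _ = (∑ B ∈ U.powerset, (4 * w) ^ B.card) * X.expect P +
          (∑ B ∈ U.powerset, w ^ B.card) * (b * (2 * 16 ^ d * (d ^ 2 * γ))) := by
        rw [Finset.sum_mul, Finset.sum_mul, ← Finset.sum_add_distrib]
        refine Finset.sum_congr rfl fun B _ => ?_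
        rw [mul_pow]
        ring
    _ ≤ (1 + 4 * w) ^ U.card * X.expect P + 2 ^ d * (b * (2 * 16 ^ d * (d ^ 2 * γ))) := by
        rw [sum_powerset_pow_card, sum_powerset_pow_card]
        gcongr
        calc (1 + w) ^ U.card ≤ (2 : ℝ) ^ U.card := by gcongr; linarith
          _ ≤ 2 ^ d := pow_le_pow_right₀ one_le_two ((Finset.card_le_univ U).trans (by simp))
    _ = _ := by
        rw [show (32 : ℝ) = 2 * 16 by norm_num, mul_pow]
        ring

/-- The moments of the square function: the factors are integrated out one at a time. After `m` of
them the remaining weights have grown from `w` to `(1 + δ)^m w ≤ 4 w`, and `16 w ≤ δ` keeps the cost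
of the next factor below `1 + δ` for every coordinate. -/
lemma expect_mul_squareFunction_pow_le (hX : X.IsGammaProduct γ) (hγ : 0 ≤ γ)
    (hf : X.IsGlobal r f) (hr : 1 ≤ r) (hθ : 0 ≤ θ) (hθr : θ * r = 1) (hf1 : X.l2 f = 1)
    {w δ : ℝ} (hw : 0 ≤ w) (hwδ : 16 * w ≤ δ) (hδ1 : δ ≤ 1) (m : ℕ) (hm : (1 + δ) ^ m ≤ 4)
    (hP : DependsOn P (U : Set (Fin d))) (hP0 : ∀ x, 0 < X.weight x → 0 ≤ P x)
    (hPb : ∀ x, 0 < X.weight x → P x ≤ b) (hb : 0 ≤ b) :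
    X.expect (fun x => P x * (∑ S, w ^ S.card * X.component θ f S x ^ 2) ^ m) ≤
      ((1 + δ) ^ m) ^ U.card * X.expect P +
        b * (m * 8 ^ (d * m) * (2 * 128 ^ d * (d ^ 2 * γ))) := by
  have hδ0 : 0 ≤ δ := by linarith
  induction m generalizing P U b with
  | zero => simp
  | succ m ih =>
    have hm' : (1 + δ) ^ m ≤ 4 :=
      (pow_le_pow_right₀ (by linarith) (Nat.le_succ m)).trans hm
    have hm1 : 1 ≤ (1 + δ) ^ m := one_le_pow₀ (by linarith)
    set L : ℝ := (1 + δ) ^ m with hL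
    set h : Finset (Fin d) → (∀ i, Ω i) → ℝ := X.component θ f with hh
    set F : (∀ i, Ω i) → ℝ := fun x => ∑ S, w ^ S.card * h S x ^ 2 with hF
    set η : ℝ := d ^ 2 * γ with hη
    have hη0 : 0 ≤ η := by positivity
    set e : ℝ := m * 8 ^ (d * m) * (2 * 128 ^ d * η) with he
    have he0 : 0 ≤ e := by positivity
    have hcard : ∀ S : Finset (Fin d), S.card ≤ d := fun S =>
      (Finset.card_le_univ S).trans (by simp)
    have hS : ∀ S : Finset (Fin d), X.expect (fun x => (P x * h S x ^ 2) * F x ^ m) ≤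
        L ^ U.card * (L ^ S.card * X.expect fun x => P x * h S x ^ 2) + b * 4 ^ d * e := by
      intro S
      have hpos : 0 ≤ X.expect fun x => P x * h S x ^ 2 :=
        X.expect_nonneg fun x hx => mul_nonneg (hP0 x hx) (sq_nonneg _)
      have := ih hm' (P := fun x => P x * h S x ^ 2) (U := U ∪ S) (b := b * 4 ^ d)
        (fun x y hxy => by
          have h1 : P x = P y := hP fun i hi => hxy i (by simp [Finset.mem_coe.1 hi])
          have h2 : h S x = h S y := X.dependsOn_component θ f S fun i hi =>
            hxy i (by simp [Finset.mem_coe.1 hi])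
          simp only [h1, h2])
        (fun x hx => mul_nonneg (hP0 x hx) (sq_nonneg _))
        (fun x hx => by
          have h1 := hf.abs_component_le hr hθ hθr S hx
          rw [hf1, mul_one] at h1
          have h2 : h S x ^ 2 ≤ 4 ^ d := by
            calc h S x ^ 2 = |h S x| ^ 2 := (sq_abs _).symm
              _ ≤ (2 ^ S.card) ^ 2 := pow_le_pow_left₀ (abs_nonneg _) h1 2
              _ ≤ (2 ^ d) ^ 2 := by
                gcongr
                · exact one_le_two
                · exact hcard S
              _ = 4 ^ d := by rw [← pow_mul, mul_comm, pow_mul]; norm_num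
          exact mul_le_mul (hPb x hx) h2 (sq_nonneg _) hb)
        (by positivity)
      refine this.trans (add_le_add ?_ le_rfl)
      rw [← mul_assoc, ← pow_add]
      refine mul_le_mul_of_nonneg_right (pow_le_pow_right₀ hm1 (Finset.card_union_le U S)) hpos
    have hw1 : w * L ≤ 1 := by nlinarith
    have hkey := expect_mul_squareFunction_le hX hγ hf hr hθ hθr hf1 hP hP0 hPb hb
      (w := w * L) (by positivity) hw1
    have hEP : 0 ≤ X.expect P := X.expect_nonneg hP0
    have hLU : L ^ U.card ≤ 4 ^ d :=
      (pow_le_pow_left₀ (by linarith) hm' _).trans (pow_le_pow_right₀ (by norm_num) (hcard U))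
    calc X.expect (fun x => P x * F x ^ (m + 1))
        = ∑ S, w ^ S.card * X.expect fun x => (P x * h S x ^ 2) * F x ^ m := by
          simp only [← expect_const_mul, ← expect_sum]
          congr 1
          funext x
          rw [pow_succ, mul_comm (F x ^ m), ← mul_assoc]
          conv_lhs => rw [hF]
          simp only [Finset.mul_sum, Finset.sum_mul]
          refine Finset.sum_congr rfl fun S _ => ?_
          ring
      _ ≤ ∑ S, w ^ S.card * (L ^ U.card * (L ^ S.card * X.expect fun x => P x * h S x ^ 2) +
            b * 4 ^ d * e) := by
          gcongr with S
          exact hS S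
      _ = L ^ U.card * X.expect (fun x => P x * ∑ S, (w * L) ^ S.card * h S x ^ 2) +
            (∑ S : Finset (Fin d), w ^ S.card) * (b * 4 ^ d * e) := by
          simp only [Finset.mul_sum, expect_sum]
          rw [Finset.sum_mul, ← Finset.sum_add_distrib]
          refine Finset.sum_congr rfl fun S _ => ?_
          rw [mul_add]
          congr 1
          have : X.expect (fun x => P x * ((w * L) ^ S.card * h S x ^ 2)) =
              (w * L) ^ S.card * X.expect fun x => P x * h S x ^ 2 := by
            rw [← expect_const_mul]
            congr 1
            funext x
            ring
          rw [this, mul_pow]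
          ring
      _ ≤ L ^ U.card * ((1 + δ) ^ U.card * X.expect P + b * (2 * 32 ^ d * η)) +
            2 ^ d * (b * 4 ^ d * e) := by
          gcongr
          · refine hkey.trans ?_
            gcongr
            nlinarith
          · calc ∑ S : Finset (Fin d), w ^ S.card = (1 + w) ^ d := by
                  rw [← Finset.powerset_univ, sum_powerset_pow_card]; simp
              _ ≤ 2 ^ d := by gcongr; linarith
      _ ≤ ((1 + δ) ^ (m + 1)) ^ U.card * X.expect P + 4 ^ d * (b * (2 * 32 ^ d * η)) +
            2 ^ d * (b * 4 ^ d * e) := by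
          rw [mul_add, ← mul_assoc, ← mul_pow, ← pow_succ]
          gcongr
      _ ≤ _ := by
          rw [add_assoc]
          refine add_le_add le_rfl ?_
          have e1 : (4 : ℝ) ^ d * 32 ^ d = 128 ^ d := by rw [← mul_pow]; norm_num
          have e2 : (2 : ℝ) ^ d * 4 ^ d = 8 ^ d := by rw [← mul_pow]; norm_num
          have e3 : (1 : ℝ) ≤ 8 ^ (d * (m + 1)) := one_le_pow₀ (by norm_num)
          have e4 : (8 : ℝ) ^ d * 8 ^ (d * m) = 8 ^ (d * (m + 1)) := by rw [← pow_add]; ring_nf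
          calc _ = b * (1 * (2 * (4 ^ d * 32 ^ d) * η)) +
                b * (m * ((2 ^ d * 4 ^ d) * 8 ^ (d * m)) * (2 * 128 ^ d * η)) := by
                rw [he]; ring
            _ = b * (1 * (2 * 128 ^ d * η)) + b * (m * 8 ^ (d * (m + 1)) * (2 * 128 ^ d * η)) := by
                rw [e1, e2, e4]
            _ ≤ b * (8 ^ (d * (m + 1)) * (2 * 128 ^ d * η)) +
                b * (m * 8 ^ (d * (m + 1)) * (2 * 128 ^ d * η)) := by gcongr
            _ = _ := by push_cast; ring

end Moments

/-! ### The square function inequality -/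

section SquareFunction

lemma one_add_two_mul_add_pow_le {k : ℕ} (hk : 1 ≤ k) {t H : ℝ} (ht : t ^ 2 ≤ H) :
    (1 + 2 * t + H) ^ k ≤ 2 * k * t + (1 + 20 * k * H) ^ k := by
  have hH : 0 ≤ H := (sq_nonneg t).trans ht
  have hk1 : (1 : ℝ) ≤ k := by exact_mod_cast hk
  have hbase : 0 ≤ 1 + 2 * t + H := by nlinarith [sq_nonneg (1 + t)]
  have hkH : 0 ≤ k * H := by positivity
  rcases le_or_gt 1 (9 * (k ^ 2 * H)) with hcase | hcase
  · -- For `H` above `1 / (9 k²)` the linear term `t` is dominated by `3 k H`.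
    have htk : |t| ≤ 3 * k * H := by
      refine abs_le_of_sq_le_sq (ht.trans ?_) (by positivity)
      calc H = 1 * H := (one_mul H).symm
        _ ≤ 9 * (k ^ 2 * H) * H := by gcongr
        _ = (3 * k * H) ^ 2 := by ring
    have ht1 := neg_abs_le t
    have ht2 := le_abs_self t
    have h1 : (1 + 2 * t + H) ^ k ≤ (1 + 7 * (k * H)) ^ k := by
      have : H ≤ k * H := le_mul_of_one_le_left hH hk1
      exact pow_le_pow_left₀ hbase (by linarith) k
    have h2 : (1 + 7 * (k * H)) ^ k + k * (13 * (k * H)) ≤ (1 + 20 * k * H) ^ k := by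
      have hx : (1 : ℝ) ≤ (1 + 7 * (k * H)) := by linarith
      have hb := one_add_mul_le_pow (a := 13 * (k * H) / (1 + 7 * (k * H)))
        (by have : 0 ≤ 13 * (k * H) / (1 + 7 * (k * H)) := by positivity
            linarith) k
      have hpos : 0 < 1 + 7 * (k * H) := by linarith
      have e : (1 + 20 * k * H) ^ k =
          (1 + 7 * (k * H)) ^ k * (1 + 13 * (k * H) / (1 + 7 * (k * H))) ^ k := by
        rw [← mul_pow]
        congr 1
        field_simp
        ring
      have hp : (1 + 7 * (k * H)) ≤ (1 + 7 * (k * H)) ^ k := le_self_pow₀ hx (by omega)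
      rw [e]
      calc (1 + 7 * (k * H)) ^ k + k * (13 * (k * H))
          = (1 + 7 * (k * H)) ^ k +
              (1 + 7 * (k * H)) * (k * (13 * (k * H) / (1 + 7 * (k * H)))) := by
            field_simp
        _ ≤ (1 + 7 * (k * H)) ^ k +
              (1 + 7 * (k * H)) ^ k * (k * (13 * (k * H) / (1 + 7 * (k * H)))) := by gcongr
        _ = (1 + 7 * (k * H)) ^ k * (1 + k * (13 * (k * H) / (1 + 7 * (k * H)))) := by ring
        _ ≤ _ := by gcongr
    have h3 : -(2 * k * t) ≤ k * (13 * (k * H)) := by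
      have : -t ≤ 3 * k * H := by linarith
      nlinarith
    linarith
  · -- For smaller `H` the left-hand side is at most `exp (k (2 t + H))`, with a bounded exponent.
    set s := √H with hs
    have hs0 : 0 ≤ s := Real.sqrt_nonneg H
    have hsH : s ^ 2 = H := Real.sq_sqrt hH
    have hts : |t| ≤ s := abs_le_of_sq_le_sq (by rw [hsH]; exact ht) hs0
    have hks : 3 * (k * s) ≤ 1 := by
      have : (3 * (k * s)) ^ 2 ≤ 1 ^ 2 := by nlinarith
      exact (abs_le_of_sq_le_sq' this zero_le_one).2
    have hs1 : s ≤ 1 := by nlinarith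
    have hHs : H ≤ s := by nlinarith
    have hu : |2 * t + H| ≤ 3 * s := by
      rw [abs_le] at hts ⊢
      constructor <;> linarith
    have hku : |k * (2 * t + H)| ≤ 1 := by
      rw [abs_mul, abs_of_nonneg (by positivity : (0 : ℝ) ≤ k)]
      nlinarith
    have hexp := (abs_le.1 (Real.abs_exp_sub_one_sub_id_le hku)).2
    have hle : (1 + 2 * t + H) ^ k ≤ Real.exp (k * (2 * t + H)) := by
      rw [Real.exp_nat_mul]
      refine pow_le_pow_left₀ hbase ?_ k
      linarith [Real.add_one_le_exp (2 * t + H)]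
    have hsq : (k * (2 * t + H)) ^ 2 ≤ 9 * (k ^ 2 * H) := by
      have : (2 * t + H) ^ 2 ≤ (3 * s) ^ 2 := by
        rw [← sq_abs (2 * t + H)]
        gcongr
      calc (k * (2 * t + H)) ^ 2 = k ^ 2 * (2 * t + H) ^ 2 := by ring
        _ ≤ k ^ 2 * (3 * s) ^ 2 := by gcongr
        _ = 9 * (k ^ 2 * H) := by rw [← hsH]; ring
    have hb := one_add_mul_le_pow (a := 20 * k * H) (by nlinarith) k
    nlinarith

/-- A pointwise Bonami-type inequality for `‖a + h‖^{2k}`, where `A = ‖a‖²`, `t = ⟪a, h⟫` and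
`H = ‖h‖²`. The first term on the right has mean zero if `h` is a martingale difference over `a`. -/
lemma add_two_mul_add_pow_le {k : ℕ} (hk : 1 ≤ k) {A t H : ℝ} (hA : 0 ≤ A) (hH : 0 ≤ H)
    (ht : t ^ 2 ≤ A * H) :
    (A + 2 * t + H) ^ k ≤ 2 * k * (A ^ (k - 1) * t) + (A + 20 * k * H) ^ k := by
  have hk1 : (1 : ℝ) ≤ k := by exact_mod_cast hk
  rcases hA.eq_or_lt with rfl | hA
  · have ht0 : t = 0 := by nlinarith
    subst ht0
    simp only [mul_zero, zero_add]
    gcongr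
    nlinarith
  · have h := one_add_two_mul_add_pow_le hk (t := t / A) (H := H / A) (by
      rw [div_pow, div_le_div_iff₀ (by positivity) hA]
      nlinarith)
    have h2 := mul_le_mul_of_nonneg_left h (pow_nonneg hA.le k)
    rw [mul_add, ← mul_pow, ← mul_pow] at h2
    have e1 : A * (1 + 2 * (t / A) + H / A) = A + 2 * t + H := by field_simp
    have e2 : A * (1 + 20 * k * (H / A)) = A + 20 * k * H := by field_simp
    have e3 : A ^ k * (2 * k * (t / A)) = 2 * k * (A ^ (k - 1) * t) := by
      obtain ⟨m, rfl⟩ : ∃ m, k = m + 1 := ⟨k - 1, by omega⟩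
      rw [Nat.add_sub_cancel, pow_succ]
      field_simp
    rwa [e1, e2, e3] at h2

variable {d : ℕ} {Ω : Fin d → Type u} [∀ i, Fintype (Ω i)] {X : PartiteComplex Ω}

/-- Splitting every member of a vector-valued function into its conditional expectation given `x_V`
and the rest. This step is exact and needs no spectral hypothesis. -/
lemma expect_sum_sq_pow_le {ι : Type*} (s : Finset ι) (a : ι → ℝ) (ha : ∀ j, 0 ≤ a j)
    (K : ι → (∀ i, Ω i) → ℝ) (V : Finset (Fin d)) {k : ℕ} (hk : 1 ≤ k) :
    X.expect (fun x => (∑ j ∈ s, a j * K j x ^ 2) ^ k) ≤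
      X.expect fun x => (∑ j ∈ s, a j * (X.avg V (K j) x ^ 2 +
        20 * k * (K j x - X.avg V (K j) x) ^ 2)) ^ k := by
  set A : (∀ i, Ω i) → ℝ := fun x => ∑ j ∈ s, a j * X.avg V (K j) x ^ 2 with hA
  set t : (∀ i, Ω i) → ℝ := fun x =>
    ∑ j ∈ s, a j * (X.avg V (K j) x * (K j x - X.avg V (K j) x)) with ht
  set H : (∀ i, Ω i) → ℝ := fun x => ∑ j ∈ s, a j * (K j x - X.avg V (K j) x) ^ 2 with hH
  have hA0 : ∀ x, 0 ≤ A x := fun x => Finset.sum_nonneg fun j _ => mul_nonneg (ha j) (sq_nonneg _)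
  have hH0 : ∀ x, 0 ≤ H x := fun x => Finset.sum_nonneg fun j _ => mul_nonneg (ha j) (sq_nonneg _)
  have hCS : ∀ x, t x ^ 2 ≤ A x * H x := fun x =>
    Finset.sum_sq_le_sum_mul_sum_of_sq_le_mul _ (fun j _ => mul_nonneg (ha j) (sq_nonneg _))
      (fun j _ => mul_nonneg (ha j) (sq_nonneg _)) (fun j _ => le_of_eq (by ring))
  have hAdep : DependsOn A (V : Set (Fin d)) := fun x y hxy => by
    simp only [hA]
    exact Finset.sum_congr rfl fun j _ => by rw [X.dependsOn_avg V (K j) hxy]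
  have hmean : X.expect (fun x => A x ^ (k - 1) * t x) = 0 := by
    have : ∀ j, X.expect (fun x => (A x ^ (k - 1) * X.avg V (K j) x) *
        (K j x - X.avg V (K j) x)) = 0 := by
      intro j
      simp only [mul_sub]
      rw [expect_sub, X.expect_mul_avg (S := V) (g := fun x => A x ^ (k - 1) * X.avg V (K j) x)
        (fun x y hxy => by simp only [hAdep hxy, X.dependsOn_avg V (K j) hxy]), sub_self]
    calc X.expect (fun x => A x ^ (k - 1) * t x)
        = X.expect fun x => ∑ j ∈ s, a j * ((A x ^ (k - 1) * X.avg V (K j) x) *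
            (K j x - X.avg V (K j) x)) := by
          congr 1
          funext x
          simp only [ht, Finset.mul_sum]
          exact Finset.sum_congr rfl fun j _ => by ring
      _ = 0 := by simp only [expect_sum, expect_const_mul, this, mul_zero, Finset.sum_const_zero]
  have hpt : ∀ x, (∑ j ∈ s, a j * K j x ^ 2) ^ k ≤ 2 * k * (A x ^ (k - 1) * t x) +
      (∑ j ∈ s, a j * (X.avg V (K j) x ^ 2 + 20 * k * (K j x - X.avg V (K j) x) ^ 2)) ^ k := by
    intro x
    have e1 : ∑ j ∈ s, a j * K j x ^ 2 = A x + 2 * t x + H x := by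
      simp only [hA, ht, hH, Finset.mul_sum, ← Finset.sum_add_distrib]
      exact Finset.sum_congr rfl fun j _ => by ring
    have e2 : ∑ j ∈ s, a j * (X.avg V (K j) x ^ 2 + 20 * k * (K j x - X.avg V (K j) x) ^ 2) =
        A x + 20 * k * H x := by
      simp only [hA, hH, Finset.mul_sum, ← Finset.sum_add_distrib]
      exact Finset.sum_congr rfl fun j _ => by ring
    rw [e1, e2]
    exact add_two_mul_add_pow_le hk (hA0 x) (hH0 x) (hCS x)
  refine (X.expect_mono fun x _ => hpt x).trans (le_of_eq ?_)
  rw [expect_add, expect_const_mul, hmean, mul_zero, zero_add]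

/-- For a family `g`, the part `∑_{R ⊆ W} g(S ∪ R)` of its sum that meets `Wᶜ` exactly in `S`. -/
def blockSum (g : Finset (Fin d) → (∀ i, Ω i) → ℝ) (W S : Finset (Fin d)) : (∀ i, Ω i) → ℝ :=
  fun x => ∑ R ∈ W.powerset, g (S ∪ R) x

lemma blockSum_insert (g : Finset (Fin d) → (∀ i, Ω i) → ℝ) {W : Finset (Fin d)} {i : Fin d}
    (hi : i ∉ W) (S : Finset (Fin d)) (x : ∀ i, Ω i) :
    blockSum g (insert i W) S x = blockSum g W S x + blockSum g W (insert i S) x := by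
  simp only [blockSum]
  rw [Finset.sum_powerset_insert hi]
  simp only [Finset.union_insert, Finset.insert_union]

variable {g : Finset (Fin d) → (∀ i, Ω i) → ℝ} {ε c : ℝ}

lemma abs_blockSum_le (hg : ∀ S x, 0 < X.weight x → |g S x| ≤ 1) (W S : Finset (Fin d))
    {x : ∀ i, Ω i} (hx : 0 < X.weight x) : |blockSum g W S x| ≤ 2 ^ d := by
  calc |blockSum g W S x| ≤ ∑ R ∈ W.powerset, |g (S ∪ R) x| := Finset.abs_sum_le_sum_abs _ _
    _ ≤ ∑ R ∈ W.powerset, 1 := Finset.sum_le_sum fun R _ => hg _ x hx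
    _ = (2 : ℝ) ^ W.card := by simp
    _ ≤ 2 ^ d := pow_le_pow_right₀ one_le_two ((Finset.card_le_univ W).trans (by simp))

/-- Processing one coordinate `i` in the square function inequality. The components that contain
`i` are almost killed by averaging over `x_i`, and those that do not are fixed. -/
lemma expect_blockSum_insert_le (hdep : ∀ S, DependsOn (g S) (S : Set (Fin d)))
    (hg : ∀ S x, 0 < X.weight x → |g S x| ≤ 1) (hε : 0 ≤ ε)
    (hgε : ∀ S, ∀ i ∈ S, X.l2 (X.avg {i}ᶜ (g S)) ≤ ε) {k : ℕ} (hk : 1 ≤ k) (hc : c = 20 * k)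
    {J W : Finset (Fin d)} {i : Fin d} (hiJ : i ∉ J) (hiW : i ∉ W) :
    X.expect (fun x => (∑ S ∈ J.powerset, c ^ S.card * blockSum g (insert i W) S x ^ 2) ^ k) ≤
      X.expect (fun x => (∑ S ∈ (insert i J).powerset, c ^ S.card * blockSum g W S x ^ 2) ^ k) +
        k * (8 ^ (d + 1) * c ^ (d + 1)) ^ k * ε := by
  have hk1 : (1 : ℝ) ≤ k := by exact_mod_cast hk
  have hc1 : 1 ≤ c := by linarith
  have hc0 : 0 ≤ c := by linarith
  have hcardd : ∀ S : Finset (Fin d), S.card ≤ d := fun S => (Finset.card_le_univ S).trans (by simp)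
  have hJcard : (J.powerset.card : ℝ) ≤ 2 ^ d := by
    rw [Finset.card_powerset]
    push_cast
    exact pow_le_pow_right₀ one_le_two (hcardd J)
  set u : Finset (Fin d) → (∀ i, Ω i) → ℝ := fun S => blockSum g W S with hu
  set v : Finset (Fin d) → (∀ i, Ω i) → ℝ := fun S => blockSum g W (insert i S) with hv
  set D : Finset (Fin d) → (∀ i, Ω i) → ℝ := fun S => X.avg {i}ᶜ (v S) with hD
  have hub : ∀ S x, 0 < X.weight x → |u S x| ≤ 2 ^ d := fun S x hx => abs_blockSum_le hg W S hx
  have hvb : ∀ S x, 0 < X.weight x → |v S x| ≤ 2 ^ d := fun S x hx => abs_blockSum_le hg W _ hx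
  have hDb : ∀ S x, 0 < X.weight x → |D S x| ≤ 2 ^ d := fun S x hx => X.abs_avg_le (hvb S) hx
  have hDε : ∀ S, X.expect (fun x => |D S x|) ≤ 2 ^ d * ε := by
    intro S
    refine (X.expect_abs_le_l2 _).trans ?_
    have e : D S = fun x => ∑ R ∈ W.powerset, X.avg {i}ᶜ (g (insert i S ∪ R)) x := by
      funext x
      exact X.avg_sum _ _ (fun R => g (insert i S ∪ R)) x
    rw [e]
    calc _ ≤ ∑ R ∈ W.powerset, X.l2 (X.avg {i}ᶜ (g (insert i S ∪ R))) := X.l2_sum_le _ _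
      _ ≤ ∑ R ∈ W.powerset, ε := Finset.sum_le_sum fun R _ => hgε _ i (by simp)
      _ = 2 ^ W.card * ε := by simp
      _ ≤ 2 ^ d * ε := by gcongr; exacts [one_le_two, hcardd W]
  -- `Q` is what the exact inequality produces, `Q'` is the square function one step further on.
  set Q : (∀ i, Ω i) → ℝ := fun x =>
    ∑ S ∈ J.powerset, c ^ S.card * ((u S x + D S x) ^ 2 + c * (v S x - D S x) ^ 2) with hQ
  set Q' : (∀ i, Ω i) → ℝ := fun x =>
    ∑ S ∈ J.powerset, c ^ S.card * (u S x ^ 2 + c * v S x ^ 2) with hQ'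
  have hstep : X.expect (fun x => (∑ S ∈ J.powerset,
      c ^ S.card * blockSum g (insert i W) S x ^ 2) ^ k) ≤ X.expect fun x => Q x ^ k := by
    refine (expect_sum_sq_pow_le J.powerset (fun S => c ^ S.card) (fun S => pow_nonneg hc0 _)
      (fun S => blockSum g (insert i W) S) {i}ᶜ hk).trans (le_of_eq ?_)
    refine X.expect_congr fun x hx => ?_
    congr 1
    refine Finset.sum_congr rfl fun S hS => ?_
    have hiS : i ∉ S := fun h => hiJ (Finset.mem_powerset.1 hS h)
    have e1 : X.avg {i}ᶜ (blockSum g (insert i W) S) x = u S x + D S x := by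
      have : blockSum g (insert i W) S = fun x => u S x + v S x :=
        funext fun x => blockSum_insert g hiW S x
      rw [this, avg_add]
      congr 1
      refine X.avg_eq_self (dependsOn_sum _ fun R hR => (hdep (S ∪ R)).mono fun j hj => ?_) hx
      simp only [Finset.coe_compl, Finset.coe_singleton, Set.mem_compl_iff, Set.mem_singleton_iff]
      rintro rfl
      rcases Finset.mem_union.1 (Finset.mem_coe.1 hj) with h | h
      · exact hiS h
      · exact hiW (Finset.mem_powerset.1 hR h)
    rw [e1, blockSum_insert g hiW S x, ← hc]
    congr 2
    simp only [hu, hv]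
    ring
  have hQ'eq : ∀ x, ∑ S ∈ (insert i J).powerset, c ^ S.card * blockSum g W S x ^ 2 = Q' x := by
    intro x
    rw [Finset.sum_powerset_insert hiJ, ← Finset.sum_add_distrib]
    refine Finset.sum_congr rfl fun S hS => ?_
    have hiS : i ∉ S := fun h => hiJ (Finset.mem_powerset.1 hS h)
    rw [Finset.card_insert_of_notMem hiS]
    simp only [hu, hv]
    ring
  set M : ℝ := 8 ^ (d + 1) * c ^ (d + 1) with hM
  have h8 : (8 : ℝ) ^ d = 2 ^ d * 2 ^ d * 2 ^ d := by rw [← mul_pow, ← mul_pow]; norm_num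
  have hM0 : 0 ≤ M := by positivity
  have hsumM : ∀ p q : Finset (Fin d) → ℝ, (∀ S, |p S| ≤ 2 * 2 ^ d) → (∀ S, |q S| ≤ 2 * 2 ^ d) →
      |∑ S ∈ J.powerset, c ^ S.card * (p S ^ 2 + c * q S ^ 2)| ≤ M := by
    intro p q hp hq
    rw [abs_of_nonneg (Finset.sum_nonneg fun S _ => by positivity)]
    calc ∑ S ∈ J.powerset, c ^ S.card * (p S ^ 2 + c * q S ^ 2)
        ≤ ∑ S ∈ J.powerset, c ^ d * (c * (2 * 2 ^ d) ^ 2 + c * (2 * 2 ^ d) ^ 2) := by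
          refine Finset.sum_le_sum fun S _ => ?_
          have h1 : p S ^ 2 ≤ c * (2 * 2 ^ d) ^ 2 := by
            rw [← sq_abs]
            calc |p S| ^ 2 ≤ (2 * 2 ^ d) ^ 2 := by gcongr; exact hp S
              _ ≤ _ := le_mul_of_one_le_left (by positivity) hc1
          have h2 : q S ^ 2 ≤ (2 * 2 ^ d) ^ 2 := by
            rw [← sq_abs]
            gcongr
            exact hq S
          gcongr
          exact hcardd S
      _ = J.powerset.card * (8 * c ^ (d + 1) * (2 ^ d * 2 ^ d)) := by
          rw [Finset.sum_const, nsmul_eq_mul]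
          ring
      _ ≤ 2 ^ d * (8 * c ^ (d + 1) * (2 ^ d * 2 ^ d)) := by gcongr
      _ = M := by rw [hM, pow_succ 8, h8]; ring
  have hQM : ∀ x, 0 < X.weight x → |Q x| ≤ M := by
    intro x hx
    refine hsumM (fun S => u S x + D S x) (fun S => v S x - D S x) (fun S => ?_) fun S => ?_
    · exact (abs_add_le _ _).trans (by linarith [hub S x hx, hDb S x hx])
    · exact (abs_sub _ _).trans (by linarith [hvb S x hx, hDb S x hx])
  have hQ'M : ∀ x, 0 < X.weight x → |Q' x| ≤ M := by
    intro x hx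
    have : (0 : ℝ) ≤ 2 ^ d := by positivity
    exact hsumM (fun S => u S x) (fun S => v S x) (fun S => by linarith [hub S x hx])
      fun S => by linarith [hvb S x hx]
  have hdiff : ∀ x, 0 < X.weight x →
      |Q x - Q' x| ≤ c ^ d * (6 * c * 2 ^ d) * ∑ S ∈ J.powerset, |D S x| := by
    intro x hx
    simp only [hQ, hQ', ← Finset.sum_sub_distrib]
    rw [Finset.mul_sum]
    refine (Finset.abs_sum_le_sum_abs _ _).trans (Finset.sum_le_sum fun S _ => ?_)
    have e : c ^ S.card * ((u S x + D S x) ^ 2 + c * (v S x - D S x) ^ 2) -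
        c ^ S.card * (u S x ^ 2 + c * v S x ^ 2) =
        c ^ S.card * ((2 * u S x + D S x + c * (D S x - 2 * v S x)) * D S x) := by ring
    have h1 := hub S x hx
    have h2 := hvb S x hx
    have h3 := hDb S x hx
    have hin : |2 * u S x + D S x + c * (D S x - 2 * v S x)| ≤ 6 * c * 2 ^ d := by
      have ha : |2 * u S x + D S x| ≤ 3 * 2 ^ d := by
        rw [abs_le] at *
        constructor <;> linarith
      have hb : |D S x - 2 * v S x| ≤ 3 * 2 ^ d := by
        rw [abs_le] at *
        constructor <;> linarith
      calc _ ≤ |2 * u S x + D S x| + |c * (D S x - 2 * v S x)| := abs_add_le _ _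
        _ ≤ c * (3 * 2 ^ d) + c * (3 * 2 ^ d) := by
          rw [abs_mul, abs_of_nonneg hc0]
          gcongr
          exact ha.trans (le_mul_of_one_le_left (by positivity) hc1)
        _ = _ := by ring
    rw [e, abs_mul, abs_mul, abs_of_nonneg (pow_nonneg hc0 _), ← mul_assoc]
    gcongr
    exact hcardd S
  have hEdiff : X.expect (fun x => |Q x - Q' x|) ≤ M * ε := by
    calc X.expect (fun x => |Q x - Q' x|)
        ≤ X.expect fun x => c ^ d * (6 * c * 2 ^ d) * ∑ S ∈ J.powerset, |D S x| :=
          X.expect_mono hdiff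
      _ = c ^ d * (6 * c * 2 ^ d) * ∑ S ∈ J.powerset, X.expect fun x => |D S x| := by
          rw [expect_const_mul, expect_sum]
      _ ≤ c ^ d * (6 * c * 2 ^ d) * ∑ S ∈ J.powerset, 2 ^ d * ε := by
          gcongr with S
          exact hDε S
      _ = c ^ d * (6 * c * 2 ^ d) * (J.powerset.card * (2 ^ d * ε)) := by
          rw [Finset.sum_const, nsmul_eq_mul]
      _ ≤ c ^ d * (8 * c * 2 ^ d) * (2 ^ d * (2 ^ d * ε)) := by
          gcongr
          norm_num
      _ = M * ε := by rw [hM, pow_succ 8, h8]; ring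
  have hpow : ∀ x, 0 < X.weight x → Q x ^ k ≤ Q' x ^ k + k * M ^ (k - 1) * |Q x - Q' x| := by
    intro x hx
    have h1 := (le_abs_self _).trans (abs_pow_sub_pow_le (Q x) (Q' x) k)
    have h2 : max |Q x| |Q' x| ^ (k - 1) ≤ M ^ (k - 1) := by
      gcongr
      exact max_le (hQM x hx) (hQ'M x hx)
    have h3 : |Q x - Q' x| * k * max |Q x| |Q' x| ^ (k - 1) ≤ |Q x - Q' x| * k * M ^ (k - 1) := by
      gcongr
    linarith
  simp only [hQ'eq]
  calc _ ≤ X.expect fun x => Q x ^ k := hstep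
    _ ≤ X.expect fun x => Q' x ^ k + k * M ^ (k - 1) * |Q x - Q' x| := X.expect_mono hpow
    _ = X.expect (fun x => Q' x ^ k) + k * M ^ (k - 1) * X.expect fun x => |Q x - Q' x| := by
        rw [expect_add, expect_const_mul]
    _ ≤ X.expect (fun x => Q' x ^ k) + k * M ^ (k - 1) * (M * ε) := by gcongr
    _ = _ := by
        obtain ⟨m, rfl⟩ : ∃ m, k = m + 1 := ⟨k - 1, by omega⟩
        rw [Nat.add_sub_cancel, pow_succ M]
        ring

/-- The square function inequality: the `2k`-th moment of a sum of approximate Efron–Stein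
components is controlled by the `k`-th moment of the sum of their squares, at the cost of a factor
`20 k` for every coordinate. -/
theorem expect_sum_pow_le_squareFunction (hdep : ∀ S, DependsOn (g S) (S : Set (Fin d)))
    (hg : ∀ S x, 0 < X.weight x → |g S x| ≤ 1) (hε : 0 ≤ ε)
    (hgε : ∀ S, ∀ i ∈ S, X.l2 (X.avg {i}ᶜ (g S)) ≤ ε) {k : ℕ} (hk : 1 ≤ k) (hc : c = 20 * k) :
    X.expect (fun x => (∑ S, g S x) ^ (2 * k)) ≤
      X.expect (fun x => (∑ S, c ^ S.card * g S x ^ 2) ^ k) +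
        d * (k * (8 ^ (d + 1) * c ^ (d + 1)) ^ k * ε) := by
  have key : ∀ W J : Finset (Fin d), Disjoint J W →
      X.expect (fun x => (∑ S ∈ J.powerset, c ^ S.card * blockSum g W S x ^ 2) ^ k) ≤
        X.expect (fun x => (∑ S ∈ (J ∪ W).powerset, c ^ S.card * blockSum g ∅ S x ^ 2) ^ k) +
          W.card * (k * (8 ^ (d + 1) * c ^ (d + 1)) ^ k * ε) := by
    intro W
    induction W using Finset.induction_on with
    | empty => simp
    | insert i W hi ih =>
      intro J hJ
      rw [Finset.disjoint_insert_right] at hJ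
      have h1 := expect_blockSum_insert_le (X := X) hdep hg hε hgε hk hc hJ.1 hi
      have h2 := ih (insert i J) (by rw [Finset.disjoint_insert_left]; exact ⟨hi, hJ.2⟩)
      rw [Finset.card_insert_of_notMem hi, Finset.union_insert, ← Finset.insert_union]
      push_cast
      linarith
  have h := key Finset.univ ∅ (by simp)
  simpa [blockSum, pow_mul] using h

end SquareFunction

/-! ### Hypercontractivity of the noise operator -/

section Hypercontractivity

/-- The total error in the `2k`-th moment of the noise operator, relative to `‖f‖_2 ^ (2k)`. -/
def momentError (d k : ℕ) (γ : ℝ) : ℝ :=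
  k * 8 ^ (d * k) * (2 * 128 ^ d * (d ^ 2 * γ)) +
    d * (k * (8 ^ (d + 1) * (20 * k : ℝ) ^ (d + 1)) ^ k * (2 ^ d * (d ^ 2 * γ)))

variable {d : ℕ} {Ω : Fin d → Type u} [∀ i, Fintype (Ω i)] {X : PartiteComplex Ω}
  {γ r ρ : ℝ} {f : (∀ i, Ω i) → ℝ}

lemma expect_noise_pow_le (hX : X.IsGammaProduct γ) (hγ : 0 ≤ γ) (hf : X.IsGlobal r f)
    (hr : 1 ≤ r) (hf1 : X.l2 f = 1) (hρ : 0 ≤ ρ) {k : ℕ} (hk : 1 ≤ k)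
    (hρr : ρ * r * (20 * k) ≤ 1) :
    X.expect (fun x => X.noise ρ f x ^ (2 * k)) ≤ 1 + momentError d k γ := by
  have hk1 : (1 : ℝ) ≤ k := by exact_mod_cast hk
  have hr0 : 0 < r := by linarith
  have hθ : 0 ≤ r⁻¹ := inv_nonneg.2 hr0.le
  have hθr : r⁻¹ * r = 1 := inv_mul_cancel₀ hr0.ne'
  -- Rescaled by `r^{-|S|}` the components are bounded, and `T_ρ f` weighs them by `σ^{|S|}`.
  set σ := ρ * r with hσ
  have hσ0 : 0 ≤ σ := mul_nonneg hρ hr0.le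
  have hσ1 : 20 * σ ≤ 1 := by nlinarith
  have hρσ : ρ = σ * r⁻¹ := by rw [hσ, mul_assoc, mul_inv_cancel₀ hr0.ne', mul_one]
  have hρ1 : ρ ≤ 1 := by nlinarith
  have hcomp : ∀ S x, X.component ρ f S x = σ ^ S.card * X.component r⁻¹ f S x := fun S x => by
    rw [hρσ, component_mul]
  have h1 := expect_sum_pow_le_squareFunction (X := X) (g := X.component ρ f)
    (ε := 2 ^ d * (d ^ 2 * γ)) (X.dependsOn_component ρ f)
    (fun S x hx => by
      have h := hf.abs_component_le hr hθ hθr S hx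
      rw [hf1, mul_one] at h
      rw [hcomp, abs_mul, abs_of_nonneg (pow_nonneg hσ0 _)]
      calc σ ^ S.card * |X.component r⁻¹ f S x| ≤ σ ^ S.card * 2 ^ S.card := by gcongr
        _ = (σ * 2) ^ S.card := (mul_pow _ _ _).symm
        _ ≤ 1 := pow_le_one₀ (by positivity) (by linarith))
    (by positivity)
    (fun S i hi => by
      simpa [hf1] using hX.l2_avg_compl_component_le hγ hρ hρ1 f hi) hk rfl
  have hδk : (1 + (k : ℝ)⁻¹) ^ k ≤ 4 := by
    have hexp : 1 + (k : ℝ)⁻¹ ≤ Real.exp (k : ℝ)⁻¹ := by linarith [Real.add_one_le_exp (k : ℝ)⁻¹]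
    calc (1 + (k : ℝ)⁻¹) ^ k ≤ Real.exp (k : ℝ)⁻¹ ^ k := by gcongr
      _ = Real.exp 1 := by rw [← Real.exp_nat_mul, mul_inv_cancel₀ (by positivity)]
      _ ≤ 4 := by linarith [Real.exp_one_lt_d9]
  have hwδ : 16 * (20 * k * σ ^ 2) ≤ (k : ℝ)⁻¹ := by
    have h : (σ * (20 * k)) ^ 2 ≤ 1 := pow_le_one₀ (by positivity) hρr
    rw [← one_div, le_div_iff₀ (by positivity)]
    nlinarith
  have h2 := expect_mul_squareFunction_pow_le (X := X) (P := fun _ => 1) (U := ∅) (b := 1)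
    hX hγ hf hr hθ hθr hf1 (w := 20 * k * σ ^ 2) (by positivity) hwδ (inv_le_one_of_one_le₀ hk1)
    k hδk (fun _ _ _ => rfl) (fun _ _ => zero_le_one) (fun _ _ => le_rfl) zero_le_one
  simp only [one_mul, Finset.card_empty, pow_zero, expect_const] at h2
  have e : ∀ x, ∑ S, (20 * k : ℝ) ^ S.card * X.component ρ f S x ^ 2 =
      ∑ S, (20 * k * σ ^ 2) ^ S.card * X.component r⁻¹ f S x ^ 2 := fun x =>
    Finset.sum_congr rfl fun S _ => by rw [hcomp]; ring
  simp only [e, ← noise_eq_sum_component] at h1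
  rw [momentError]
  linarith

lemma noise_const_mul (a ρ : ℝ) (f : (∀ i, Ω i) → ℝ) (x : ∀ i, Ω i) :
    X.noise ρ (fun y => a * f y) x = a * X.noise ρ f x := by
  simp only [noise, avg_const_mul, Finset.mul_sum]
  exact Finset.sum_congr rfl fun S _ => by ring

lemma IsGlobal.const_mul (hf : X.IsGlobal r f) (a : ℝ) : X.IsGlobal r fun y => a * f y := by
  intro S τ hτ
  have h := hf S τ hτ
  rw [pNorm_two_eq_l2, pNorm_two_eq_l2] at h ⊢
  rw [l2_const_mul, l2_const_mul]
  nlinarith [abs_nonneg a]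

lemma momentError_nonneg (d k : ℕ) (hγ : 0 ≤ γ) : 0 ≤ momentError d k γ := by
  rw [momentError]
  positivity

/-- The normalisation `‖f‖_2 = 1` is removed by scaling. If `‖f‖_2 = 0`, globalness forces the
noise operator to vanish on the support. -/
lemma expect_noise_pow_le_mul (hX : X.IsGammaProduct γ) (hγ : 0 ≤ γ) (hf : X.IsGlobal r f)
    (hr : 1 ≤ r) (hρ : 0 ≤ ρ) {k : ℕ} (hk : 1 ≤ k) (hρr : ρ * r * (20 * k) ≤ 1) :
    X.expect (fun x => X.noise ρ f x ^ (2 * k)) ≤ (1 + momentError d k γ) * X.l2 f ^ (2 * k) := by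
  rcases (X.l2_nonneg f).eq_or_lt with h0 | h0
  · have hz : ∀ x, 0 < X.weight x → X.noise ρ f x ^ (2 * k) = 0 := by
      intro x hx
      rw [noise, Finset.sum_eq_zero, zero_pow (by omega)]
      intro S _
      have h := hf.abs_avg_le (by linarith) S hx
      rw [← h0, mul_zero] at h
      rw [abs_nonpos_iff.1 h, mul_zero]
    rw [X.expect_congr hz, expect_const, ← h0, zero_pow (by omega), mul_zero]
  · set N := X.l2 f with hN
    have h1 : X.l2 (fun y => N⁻¹ * f y) = 1 := by
      rw [l2_const_mul, abs_of_pos (inv_pos.2 h0), ← hN, inv_mul_cancel₀ h0.ne']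
    have h := expect_noise_pow_le hX hγ (hf.const_mul N⁻¹) hr h1 hρ hk hρr
    simp only [noise_const_mul, mul_pow, expect_const_mul] at h
    rw [inv_pow, inv_mul_le_iff₀ (by positivity)] at h
    linarith

/-- Each of the two error terms is at most `k ^ (21 d k) γ`. -/
lemma momentError_le {d k : ℕ} (hd : 1 ≤ d) (hk : 2 ≤ k) (hγ : 0 ≤ γ) :
    momentError d k γ ≤ (k : ℝ) ^ (22 * (d * k)) * γ := by
  have hk2 : (2 : ℝ) ≤ k := by exact_mod_cast hk
  have hk1 : (1 : ℝ) ≤ k := by linarith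
  have hn : 1 ≤ d * k := Nat.mul_pos hd (by omega)
  have h2k : ∀ a b : ℕ, a ≤ b → (2 : ℝ) ^ a ≤ (k : ℝ) ^ b := fun a b hab =>
    (pow_le_pow_left₀ (by norm_num) hk2 a).trans (pow_le_pow_right₀ hk1 hab)
  have hdk : 2 * d ≤ d * k := by nlinarith
  have hd2 : (d : ℝ) ≤ 2 ^ d := by exact_mod_cast Nat.lt_two_pow_self.le
  have hkn : (k : ℝ) ≤ (k : ℝ) ^ (d * k) := le_self_pow₀ hk1 (by omega)
  have e1 : (8 : ℝ) ^ (d * k) ≤ (k : ℝ) ^ (3 * (d * k)) := by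
    rw [show (8 : ℝ) = 2 ^ 3 by norm_num, ← pow_mul]
    exact h2k _ _ le_rfl
  have e2 : (2 : ℝ) * 128 ^ d ≤ (k : ℝ) ^ (4 * (d * k)) := by
    rw [show (128 : ℝ) = 2 ^ 7 by norm_num, ← pow_mul, ← pow_succ']
    exact h2k _ _ (by omega)
  have e3 : (d : ℝ) ^ 2 ≤ (k : ℝ) ^ (d * k) := by
    calc (d : ℝ) ^ 2 ≤ (2 ^ d) ^ 2 := by gcongr
      _ = 2 ^ (d * 2) := (pow_mul _ _ _).symm
      _ ≤ _ := h2k _ _ (by omega)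
  have e4 : (d : ℝ) * (2 ^ d * d ^ 2) ≤ (k : ℝ) ^ (2 * (d * k)) := by
    calc (d : ℝ) * (2 ^ d * d ^ 2) ≤ 2 ^ d * (2 ^ d * (2 ^ d) ^ 2) := by gcongr
      _ = 2 ^ (4 * d) := by ring
      _ ≤ _ := h2k _ _ (by omega)
  have e5 : ((8 : ℝ) ^ (d + 1) * (20 * k : ℝ) ^ (d + 1)) ^ k ≤ (k : ℝ) ^ (18 * (d * k)) := by
    have hb : 8 * (20 * (k : ℝ)) ≤ (k : ℝ) ^ 9 := by
      calc 8 * (20 * (k : ℝ)) ≤ 2 ^ 8 * k := by linarith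
        _ ≤ k ^ 8 * k := by gcongr
        _ = k ^ 9 := (pow_succ _ _).symm
    calc ((8 : ℝ) ^ (d + 1) * (20 * k : ℝ) ^ (d + 1)) ^ k
        = (8 * (20 * (k : ℝ))) ^ ((d + 1) * k) := by
          rw [← mul_pow, ← pow_mul]
      _ ≤ ((k : ℝ) ^ 9) ^ ((d + 1) * k) := by gcongr
      _ = (k : ℝ) ^ (9 * ((d + 1) * k)) := (pow_mul _ _ _).symm
      _ ≤ _ := pow_le_pow_right₀ hk1 (by nlinarith)
  have t1 : k * 8 ^ (d * k) * (2 * 128 ^ d * (d ^ 2 * γ)) ≤ (k : ℝ) ^ (21 * (d * k)) * γ := by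
    calc k * 8 ^ (d * k) * (2 * 128 ^ d * (d ^ 2 * γ))
        ≤ (k : ℝ) ^ (d * k) * k ^ (3 * (d * k)) *
          (k ^ (4 * (d * k)) * (k ^ (d * k) * γ)) := by gcongr
      _ = (k : ℝ) ^ (9 * (d * k)) * γ := by ring
      _ ≤ _ := by gcongr; norm_num
  have t2 : d * (k * (8 ^ (d + 1) * (20 * k : ℝ) ^ (d + 1)) ^ k * (2 ^ d * (d ^ 2 * γ))) ≤
      (k : ℝ) ^ (21 * (d * k)) * γ := by
    calc d * (k * (8 ^ (d + 1) * (20 * k : ℝ) ^ (d + 1)) ^ k * (2 ^ d * (d ^ 2 * γ)))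
        = k * (8 ^ (d + 1) * (20 * k : ℝ) ^ (d + 1)) ^ k * (d * (2 ^ d * d ^ 2)) * γ := by ring
      _ ≤ (k : ℝ) ^ (d * k) * k ^ (18 * (d * k)) * k ^ (2 * (d * k)) * γ := by gcongr
      _ = _ := by ring
  calc momentError d k γ ≤ 2 * ((k : ℝ) ^ (21 * (d * k)) * γ) := by
        rw [momentError]; linarith
    _ ≤ (k : ℝ) ^ (d * k) * ((k : ℝ) ^ (21 * (d * k)) * γ) := by
        gcongr
        linarith
    _ = _ := by ring

/-- With `L = q d log q`, the spectral hypothesis gives `γ = e^{-y}` with `y ≥ 27 L`, so that the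
error `e^{11 L} γ` is at most `e^{-y/2} ≤ 2 / y`. -/
lemma momentError_le_div_log {d k : ℕ} (hk : 2 ≤ k) (hγ : 0 < γ)
    (h : γ ≤ (2 : ℝ) ^ (-(40 * (((2 * k : ℕ) : ℝ) * (d : ℝ) * Real.log ((2 * k : ℕ) : ℝ))))) :
    momentError d k γ ≤
      40 * (((2 * k : ℕ) : ℝ) * (d : ℝ) * Real.log ((2 * k : ℕ) : ℝ)) / Real.log (1 / γ) := by
  rcases Nat.eq_zero_or_pos d with rfl | hd
  · simp [momentError]
  have hk2 : (2 : ℝ) ≤ k := by exact_mod_cast hk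
  have hd1 : (1 : ℝ) ≤ d := by exact_mod_cast hd
  have hq : ((2 * k : ℕ) : ℝ) = 2 * k := by push_cast; ring
  have hlog : 1 / 4 ≤ Real.log (2 * k : ℝ) := by
    have := Real.log_le_log (by norm_num) (show (2 : ℝ) ≤ 2 * k by linarith)
    linarith [Real.log_two_gt_d9]
  rw [hq] at h ⊢
  set L : ℝ := 2 * k * d * Real.log (2 * k) with hL
  have hL1 : 1 ≤ L := by
    have h1 : 4 ≤ 2 * (k : ℝ) * d := by nlinarith
    rw [hL]
    nlinarith
  set y : ℝ := Real.log (1 / γ) with hy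
  have hyγ : γ = Real.exp (-y) := by
    rw [hy, one_div, Real.log_inv, neg_neg, Real.exp_log hγ]
  have hyL : 27 * L ≤ y := by
    have h1 := Real.log_le_log hγ h
    rw [Real.log_rpow two_pos] at h1
    have h2 : y = -Real.log γ := by rw [hy, one_div, Real.log_inv]
    nlinarith [Real.log_two_gt_d9]
  have hy0 : 0 < y := by linarith
  have hkL : (k : ℝ) ^ (22 * (d * k)) ≤ Real.exp (11 * L) := by
    have h1 : (k : ℝ) ≤ Real.exp (Real.log (2 * k)) := by
      rw [Real.exp_log (by linarith)]
      linarith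
    calc (k : ℝ) ^ (22 * (d * k)) ≤ Real.exp (Real.log (2 * k)) ^ (22 * (d * k)) := by gcongr
      _ = Real.exp (11 * L) := by
          rw [← Real.exp_nat_mul, hL]
          congr 1
          push_cast
          ring
  calc momentError d k γ ≤ (k : ℝ) ^ (22 * (d * k)) * γ := momentError_le hd hk hγ.le
    _ ≤ Real.exp (11 * L) * Real.exp (-y) := by rw [← hyγ]; gcongr
    _ = Real.exp (11 * L - y) := by rw [← Real.exp_add, sub_eq_add_neg]
    _ ≤ Real.exp (-(y / 2)) := Real.exp_le_exp.2 (by linarith)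
    _ ≤ 2 / y := by
        rw [Real.exp_neg, inv_le_comm₀ (Real.exp_pos _) (by positivity), inv_div]
        linarith [Real.add_one_le_exp (y / 2)]
    _ ≤ 40 * L / y := by
        gcongr
        linarith

end Hypercontractivity

end PartiteComplex

end

open PartiteComplex in
theorem mainTheorem4 :
    ∃ (C κ : ℝ) (c : ℕ → ℕ → ℝ → ℝ), 0 < C ∧ 0 < κ ∧
      (∀ d q : ℕ, Tendsto (c d q) (𝓝[>] 0) (𝓝 0)) ∧
      ∀ (d q : ℕ) (γ : ℝ), 2 < q → Even q → 0 < γ →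
        γ ≤ (2 : ℝ) ^ (-(C * ((q : ℝ) * (d : ℝ) * Real.log q))) →
        c d q γ ≤ C * ((q : ℝ) * (d : ℝ) * Real.log q) / Real.log (1 / γ) ∧
        ∀ (Ω : Fin d → Type u) [∀ i, Fintype (Ω i)] (X : PartiteComplex Ω),
          X.IsGammaProduct γ →
          ∀ (r ρ : ℝ) (f : (∀ i, Ω i) → ℝ), 1 ≤ r → 0 ≤ ρ → ρ ≤ κ / (r * q) →
            X.IsGlobal r f →
            X.pNorm q (X.noise ρ f) ≤ (1 + c d q γ) * X.pNorm 2 f := by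
  refine ⟨40, 1 / 10, fun d q γ => 40 * ((q : ℝ) * (d : ℝ) * Real.log q) / Real.log (1 / γ),
    by norm_num, by norm_num, fun d q => ?_, ?_⟩
  · refine Tendsto.const_div_atTop ?_ _
    simp only [one_div]
    exact Real.tendsto_log_atTop.comp tendsto_inv_nhdsGT_zero
  intro d q γ hq2 hq hγ hγq
  refine ⟨le_rfl, ?_⟩
  intro Ω _ X hX r ρ f hr hρ hρr hf
  obtain ⟨k, rfl⟩ : ∃ k, q = 2 * k := hq.exists_two_nsmul _ |>.imp fun k hk => by simpa using hk
  have hk : 2 ≤ k := by omega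
  have hk1 : (1 : ℝ) ≤ k := by exact_mod_cast (by omega : 1 ≤ k)
  have herr := momentError_le_div_log hk hγ hγq
  have herr0 := momentError_nonneg d k hγ.le
  -- The weight `20 k (ρ r)²` of the square function is then at most `1 / (20 k)`.
  have hρ' : ρ * r * (20 * k) ≤ 1 := by
    rw [le_div_iff₀ (by positivity)] at hρr
    push_cast at hρr
    nlinarith
  have hmom := expect_noise_pow_le_mul hX hγ.le hf hr hρ (by omega : 1 ≤ k) hρ'
  rw [pNorm_two_eq_l2, pNorm]
  have hpow : X.expect (fun x => |X.noise ρ f x| ^ ((2 * k : ℕ) : ℝ)) =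
      X.expect fun x => X.noise ρ f x ^ (2 * k) := by
    congr 1
    funext x
    rw [Real.rpow_natCast, Even.pow_abs ⟨k, by ring⟩]
  rw [hpow]
  have hN := X.l2_nonneg f
  have hpos : 0 ≤ X.expect fun x => X.noise ρ f x ^ (2 * k) :=
    X.expect_nonneg fun x _ => Even.pow_nonneg ⟨k, by ring⟩ _
  have hinv : 1 / ((2 * k : ℕ) : ℝ) ≤ 1 := by
    rw [div_le_one (by positivity)]
    push_cast
    linarith
  calc (X.expect fun x => X.noise ρ f x ^ (2 * k)) ^ (1 / ((2 * k : ℕ) : ℝ))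
      ≤ ((1 + momentError d k γ) * X.l2 f ^ (2 * k)) ^ (1 / ((2 * k : ℕ) : ℝ)) := by gcongr
    _ = (1 + momentError d k γ) ^ (1 / ((2 * k : ℕ) : ℝ)) * X.l2 f := by
        rw [Real.mul_rpow (by linarith) (by positivity), one_div,
          Real.pow_rpow_inv_natCast hN (by omega)]
    _ ≤ (1 + momentError d k γ) ^ (1 : ℝ) * X.l2 f := by
        gcongr
        linarith
    _ ≤ _ := by
        rw [Real.rpow_one]
        gcongr
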